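/- Let $N\ge 1$, $\beta\ge 0$, let $W\in\mathbb{R}^{N\times N}$ be symmetric and $h\in\mathbb{R}^N$. Let $\nu_{\beta,h}$ be the Gibbs measure on $\{-1,1\}^N$ with $\nu_{\beta,h}(x)\propto \exp\bigl(-\tfrac{\beta}{2}\langle x,Wx\rangle+\langle x,h\rangle\bigr)$. Write $|h|:=\min_{i}|h_i|$ for the strength of the external field and assume the large field condition $$|h|\;\ge\;2\beta\max_{i}\sum_{k\ne i}|W_{ik}|.$$ Put $$\gamma=1-\frac{|h|}{e^{3|h|/4}+e^{-3|h|/4}} .$$ The Glauber dynamics for $\nu_{\beta,h}$ is the pure jump Markov process on $\{-1,1\}^N$ with generator $$\mathcal{L}f(x)=\sum_{i=1}^N\bigl(\mathbb{E}_{\nu_{\beta,h}}[f(X)\mid X_j=x_j\ \text{for all } j\neq i]-f(x)\bigr).$$ Let $q$ be a probability distribution on $\{-1,1\}^N$, let $n\ge1$, and let $X_1,\dots,X_n$ be successive samples of this process at unit time intervals with $X_1\sim q$; that is, $(X_1,\dots,X_n)$ is a Markov chain with initial law $q$ and transition matrix $e^{\mathcal{L}}$. Then for all $\varepsilon>0$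 $$P_q\left[\,\Bigl\|\frac1n\sum_{i=1}^nX_i-\mathbb{E}_{\nu_{\beta,h}}[X]\Bigr\|\ge\varepsilon\right]\;\le\; C_{\gamma,n,q}\,\exp\left(-\frac{n\varepsilon^2\gamma}{c}\right),$$ where $\|\cdot\|$ is the Euclidean norm, $c>0$ is an absolute constant (independent of $N,\beta,W,h,q,n,\varepsilon$), and $C_{\gamma,n,q}$ is, for each $N$, the value of one fixed rational function with real coefficients, depending only on $N$, at $\gamma$, $n$ and the values $q(x)$, $x\in\{-1,1\}^N$; its denominator does not vanish there. -/

import Mathlib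

open scoped Matrix

noncomputable section

/-- The hypercube `{-1, 1}^N`; the two elements of `ℤˣ` are `1` and `-1`. -/
abbrev Config (N : ℕ) : Type := Fin N → ℤˣ

/-- A configuration regarded as a vector of the Euclidean space `ℝ^N`. -/
def Config.toVec {N : ℕ} (x : Config N) : EuclideanSpace ℝ (Fin N) :=
  WithLp.toLp 2 fun i => ((x i : ℤ) : ℝ)

/-- The unnormalized weight `exp (-(β / 2) ⟨x, W x⟩ + ⟨x, h⟩)`. -/
def gibbsWeight {N : ℕ} (β : ℝ) (W : Matrix (Fin N) (Fin N) ℝ) (h : Fin N → ℝ)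
    (x : Config N) : ℝ :=
  Real.exp (-(β / 2) * (x.toVec.ofLp ⬝ᵥ (W *ᵥ x.toVec.ofLp)) + x.toVec.ofLp ⬝ᵥ h)

/-- The Gibbs measure `ν_{β,h}`, given by its mass function. -/
def gibbs {N : ℕ} (β : ℝ) (W : Matrix (Fin N) (Fin N) ℝ) (h : Fin N → ℝ)
    (x : Config N) : ℝ :=
  gibbsWeight β W h x / ∑ y : Config N, gibbsWeight β W h y

/-- The mean `E_ν[X]` of the Gibbs measure. -/
def gibbsMean {N : ℕ} (β : ℝ) (W : Matrix (Fin N) (Fin N) ℝ) (h : Fin N → ℝ) :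
    EuclideanSpace ℝ (Fin N) :=
  ∑ x : Config N, gibbs β W h x • x.toVec

/-- The conditional probability `ν(x_i = s | x_{∼ i})`. -/
def gibbsCond {N : ℕ} (β : ℝ) (W : Matrix (Fin N) (Fin N) ℝ) (h : Fin N → ℝ)
    (x : Config N) (i : Fin N) (s : ℤˣ) : ℝ :=
  gibbsWeight β W h (Function.update x i s) /
    ∑ s' : ℤˣ, gibbsWeight β W h (Function.update x i s')

/-- The matrix of the Glauber generator
`L f (x) = ∑ i, (E_ν[f(X) | X_{∼ i} = x_{∼ i}] - f x)`. -/
def glauberGenerator {N : ℕ} (β : ℝ) (W : Matrix (Fin N) (Fin N) ℝ) (h : Fin N → ℝ) :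
    Matrix (Config N) (Config N) ℝ :=
  Matrix.of fun x y =>
    ∑ i : Fin N, ((∑ s : ℤˣ, gibbsCond β W h x i s * if Function.update x i s = y then 1 else 0)
      - if x = y then 1 else 0)

/-- The transition matrix `P_t = exp (t L)` of the Glauber dynamics over a time `t`. -/
def glauberSemigroup {N : ℕ} (β : ℝ) (W : Matrix (Fin N) (Fin N) ℝ) (h : Fin N → ℝ)
    (t : ℝ) : Matrix (Config N) (Config N) ℝ :=
  NormedSpace.exp (t • glauberGenerator β W h)

/-- `X 0, …, X (n - 1)` are `n` successive samples of the Glauber dynamics with initial law `q`,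
observed at unit time intervals: their joint law is that of the Markov chain with initial law `q`
and transition matrix `P_1`. -/
structure IsGlauberSample {N : ℕ} (β : ℝ) (W : Matrix (Fin N) (Fin N) ℝ) (h : Fin N → ℝ)
    (q : Config N → ℝ) (n : ℕ) {Ω : Type*} [MeasurableSpace Ω] (μ : MeasureTheory.Measure Ω)
    (X : ℕ → Ω → Config N) : Prop where
  measurable : ∀ i < n, ∀ a : Config N, MeasurableSet {ω | X i ω = a}
  law : ∀ m < n, ∀ a : ℕ → Config N,
    μ.real {ω | ∀ i ≤ m, X i ω = a i} =
      q (a 0) * ∏ i ∈ Finset.range m, glauberSemigroup β W h 1 (a i) (a (i + 1))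

/-- The strength of the external field: `|h| = min_i |h_i|`. -/
def fieldStrength {N : ℕ} (h : Fin N → ℝ) : ℝ := ⨅ i, |h i|

/-- The large field condition `|h| ≥ 2 β sup_i ∑_{k ≠ i} |W_{ik}|`. -/
def LargeField {N : ℕ} (β : ℝ) (W : Matrix (Fin N) (Fin N) ℝ) (h : Fin N → ℝ) : Prop :=
  2 * β * (⨆ i, ∑ k ∈ Finset.univ.erase i, |W i k|) ≤ fieldStrength h

/-- `γ = 1 - |h| / (e^{3|h|/4} + e^{-3|h|/4})`. -/
def gammaGap {N : ℕ} (h : Fin N → ℝ) : ℝ :=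
  1 - fieldStrength h /
    (Real.exp (3 * fieldStrength h / 4) + Real.exp (-(3 * fieldStrength h / 4)))

/-- The point `(γ, n, (q x)_x)` at which a rational function of `γ`, `n` and `q` is evaluated. -/
def chernoffPoint {N : ℕ} (γ : ℝ) (n : ℕ) (q : Config N → ℝ) : Fin 2 ⊕ Config N → ℝ :=
  Sum.elim ![γ, (n : ℝ)] q

end

/-! The prefactor may depend on `N` and `γ ≤ 1`, so a bound `|T| e^N exp (-n ε² / 768)` suffices,
with `T` a finite set of directions; no spectral gap is computed.

The large field condition gives Dobrushin uniqueness. Each local field keeps the sign of `h i` and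
at least half the field strength, where the sigmoid is flat, so the influence matrix has row and
column sums at most `1 / 2` (`LargeField.isInfluenceBound`). Hence the Euler steps `1 + L / m`
shrink both the sup norm and the Euclidean norm of the discrete gradient by `1 - 1 / (2m)`. They
also satisfy `Q e^g ≤ exp (Q g + lipTwo g ^ 2 / m)` when `lipInf g ≤ 1`. Iterating `m` times and
letting `m → ∞`, the kernel `P = exp L` contracts both seminorms by `2 / 3` and satisfies `P e^g ≤
exp (P g + lipTwo g ^ 2)` (`glauberSemigroup_exp_le`).

Conditioning backwards along the chain replaces the exponent `g` by `f + P g`. Since `1/3 + 2/3 =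
1`, the Lipschitz bounds persist, which bounds the exponential moment of `∑ f (X i)`
(`IsGlauberSample.integral_exp_le_aux`). For linear `f`, coefficients too large for the Lipschitz
bound are cut off at quadratic cost. Chernoff's bound in each direction and a union bound over a net
of the sphere conclude. -/

/-! ### Euler approximation of the exponential -/

/-- Telescoping; `1 ≤ r` allows the exponent `k` in place of `k - 1`. -/
theorem norm_pow_sub_pow_le_of_norm_le {𝔸 : Type*} [NormedRing 𝔸] [NormOneClass 𝔸] {a b : 𝔸}
    {r : ℝ} (hr : 1 ≤ r) (ha : ‖a‖ ≤ r) (hb : ‖b‖ ≤ r) (k : ℕ) :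
    ‖a ^ k - b ^ k‖ ≤ k * r ^ k * ‖a - b‖ := by
  induction k with
  | zero => simp
  | succ k ih =>
    have e : a ^ (k + 1) - b ^ (k + 1) = a ^ k * (a - b) + (a ^ k - b ^ k) * b := by noncomm_ring
    have hak : ‖a ^ k‖ ≤ r ^ k := (norm_pow_le a k).trans (pow_le_pow_left₀ (norm_nonneg _) ha k)
    have hr0 : (0 : ℝ) ≤ r := by linarith
    calc ‖a ^ (k + 1) - b ^ (k + 1)‖ ≤ ‖a ^ k * (a - b)‖ + ‖(a ^ k - b ^ k) * b‖ := by
          rw [e]; exact norm_add_le _ _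
      _ ≤ ‖a ^ k‖ * ‖a - b‖ + ‖a ^ k - b ^ k‖ * ‖b‖ := by gcongr <;> exact norm_mul_le _ _
      _ ≤ r ^ k * ‖a - b‖ + (k * r ^ k * ‖a - b‖) * r := by gcongr
      _ ≤ r ^ (k + 1) * ‖a - b‖ + (k * r ^ k * ‖a - b‖) * r := by
          gcongr
          omega
      _ = _ := by push_cast; ring

open Filter Topology in
/-- The Euler approximation `(1 + A / m) ^ m` of the exponential in a Banach algebra. -/
theorem tendsto_one_add_smul_pow_exp {𝔸 : Type*} [NormedRing 𝔸] [NormOneClass 𝔸]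
    [NormedAlgebra ℝ 𝔸] [CompleteSpace 𝔸] (A : 𝔸) :
    Tendsto (fun m : ℕ => (1 + (m : ℝ)⁻¹ • A) ^ m) atTop (𝓝 (NormedSpace.exp A)) := by
  let _ : NormedAlgebra ℚ 𝔸 := NormedAlgebra.restrictScalars ℚ ℝ 𝔸
  have hder : HasDerivAt (fun t : ℝ => NormedSpace.exp (t • A)) A 0 := by
    have := hasDerivAt_exp_smul_const (𝕂 := ℝ) A (0 : ℝ)
    simpa using this
  have hlim : Tendsto (fun m : ℕ => (m : ℝ) • (NormedSpace.exp ((m : ℝ)⁻¹ • A) - 1)) atTop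
      (𝓝 A) := by
    have h1 := hder.tendsto_slope_zero
    have h2 : Tendsto (fun m : ℕ => (m : ℝ)⁻¹) atTop (𝓝[≠] (0 : ℝ)) := by
      refine tendsto_nhdsWithin_iff.2 ⟨tendsto_inv_atTop_nhds_zero_nat, ?_⟩
      filter_upwards [eventually_gt_atTop 0] with m hm
      simp [hm.ne']
    simpa [Function.comp_def] using h1.comp h2
  have hlim0 : Tendsto (fun m : ℕ => ‖(m : ℝ) • (NormedSpace.exp ((m : ℝ)⁻¹ • A) - 1) - A‖) atTop
      (𝓝 0) := by
    simpa using (hlim.sub_const A).norm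
  -- Compare `m`-th powers of `a = exp (A / m)` and `b = 1 + A / m`: both norms are at most `1 +
  -- (‖A‖ + 1) / m`, and `m ‖a - b‖ → 0` by differentiability at `0`.
  have hbound : ∀ᶠ m : ℕ in atTop,
      ‖NormedSpace.exp A - (1 + (m : ℝ)⁻¹ • A) ^ m‖ ≤
        Real.exp (‖A‖ + 1) * ‖(m : ℝ) • (NormedSpace.exp ((m : ℝ)⁻¹ • A) - 1) - A‖ := by
    filter_upwards [eventually_gt_atTop 0,
      hlim0.eventually_lt_const (show (0 : ℝ) < 1 by norm_num)] with m hm hm1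
    have hm0 : (0 : ℝ) < m := by exact_mod_cast hm
    set a : 𝔸 := NormedSpace.exp ((m : ℝ)⁻¹ • A) with ha
    set b : 𝔸 := 1 + (m : ℝ)⁻¹ • A with hb
    have hab : (m : ℝ) • (a - b) = (m : ℝ) • (a - 1) - A := by
      rw [hb, ← sub_sub, smul_sub, smul_smul, mul_inv_cancel₀ hm0.ne', one_smul]
    have habn : (m : ℝ) * ‖a - b‖ = ‖(m : ℝ) • (a - 1) - A‖ := by
      rw [← hab, norm_smul, Real.norm_of_nonneg hm0.le]
    have hpow : a ^ m = NormedSpace.exp A := by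
      rw [ha, ← NormedSpace.exp_nsmul, ← Nat.cast_smul_eq_nsmul ℝ, smul_smul,
        mul_inv_cancel₀ hm0.ne', one_smul]
    have hbn : ‖b‖ ≤ 1 + ‖A‖ / m := by
      refine (norm_add_le _ _).trans ?_
      rw [norm_one, norm_smul, norm_inv, Real.norm_of_nonneg hm0.le]
      apply le_of_eq; ring
    have hr : 1 + ‖A‖ / m ≤ 1 + (‖A‖ + 1) / m := by gcongr; linarith
    have han : ‖a‖ ≤ 1 + (‖A‖ + 1) / m := by
      have h1 : ‖a - b‖ ≤ 1 / m := by
        rw [le_div_iff₀ hm0, mul_comm, habn]; exact hm1.le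
      calc ‖a‖ = ‖b + (a - b)‖ := by congr 1; abel
        _ ≤ (1 + ‖A‖ / m) + 1 / m := (norm_add_le _ _).trans (add_le_add hbn h1)
        _ = _ := by ring
    have hr1 : 1 ≤ 1 + (‖A‖ + 1) / m := by
      have : 0 ≤ (‖A‖ + 1) / m := by positivity
      linarith
    have key := norm_pow_sub_pow_le_of_norm_le hr1 han (hbn.trans hr) m
    have hexp : (1 + (‖A‖ + 1) / m) ^ m ≤ Real.exp (‖A‖ + 1) := by
      calc (1 + (‖A‖ + 1) / m) ^ m ≤ Real.exp ((‖A‖ + 1) / m) ^ m := by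
            gcongr; rw [add_comm]; exact Real.add_one_le_exp _
        _ = _ := by rw [← Real.exp_nat_mul]; congr 1; field_simp
    rw [hpow] at key
    calc _ ≤ _ := key
      _ = (1 + (‖A‖ + 1) / m) ^ m * (m * ‖a - b‖) := by ring
      _ ≤ _ := by rw [habn]; gcongr
  rw [tendsto_iff_norm_sub_tendsto_zero]
  simp_rw [norm_sub_rev _ (NormedSpace.exp A)]
  refine squeeze_zero' (Eventually.of_forall fun _ => norm_nonneg _) hbound ?_
  simpa using hlim0.const_mul (Real.exp (‖A‖ + 1))

open Filter Topology in
theorem Matrix.tendsto_one_add_smul_pow_exp {ι : Type*} [Fintype ι] [DecidableEq ι] [Nonempty ι]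
    (A : Matrix ι ι ℝ) :
    Tendsto (fun m : ℕ => (1 + (m : ℝ)⁻¹ • A) ^ m) atTop (𝓝 (NormedSpace.exp A)) := by
  -- The statement involves only the topology; this norm serves as a Banach algebra norm inducing
  -- it.
  let _ : NormedRing (Matrix ι ι ℝ) := Matrix.linftyOpNormedRing
  let _ : NormedAlgebra ℝ (Matrix ι ι ℝ) := Matrix.linftyOpNormedAlgebra
  have _ : NormOneClass (Matrix ι ι ℝ) := Matrix.linfty_opNormOneClass
  exact _root_.tendsto_one_add_smul_pow_exp A

/-! ### Flatness of the sigmoid -/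

/-- The right side is `4 + 4 sinh² (t / 2) ≥ 4 + t²`, and `(|t| - 2)² ≥ 0`. -/
theorem Real.four_mul_abs_le_two_add_exp_add_exp_neg (t : ℝ) :
    4 * |t| ≤ 2 + Real.exp t + Real.exp (-t) := by
  have h1 : |t| / 2 ≤ Real.sinh (|t| / 2) := Real.self_le_sinh_iff.2 (by positivity)
  have h2 : Real.cosh t = 1 + 2 * Real.sinh (|t| / 2) ^ 2 := by
    rw [← Real.cosh_abs, show |t| = 2 * (|t| / 2) by ring, Real.cosh_two_mul, Real.cosh_sq']
    ring_nf
  rw [Real.cosh_eq] at h2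
  have h3 : (|t| / 2) ^ 2 ≤ Real.sinh (|t| / 2) ^ 2 := by gcongr
  nlinarith [sq_nonneg (|t| - 2)]

theorem Real.sigmoid_mul_one_sub_sigmoid_le {a t : ℝ} (ha : 0 < a) (hat : a ≤ |t|) :
    Real.sigmoid t * (1 - Real.sigmoid t) ≤ 1 / (4 * a) := by
  have h := Real.four_mul_abs_le_two_add_exp_add_exp_neg t
  have e1 : Real.exp t * Real.exp (-t) = 1 := by rw [← Real.exp_add]; simp
  have e2 : Real.sigmoid t * (1 - Real.sigmoid t) = 1 / (2 + Real.exp t + Real.exp (-t)) := by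
    rw [Real.sigmoid_def]
    have := Real.exp_pos t
    have := Real.exp_pos (-t)
    field_simp
    linear_combination e1
  rw [e2]
  apply one_div_le_one_div_of_le <;> linarith

/-- Away from the origin the sigmoid function is flat. -/
theorem Real.abs_sigmoid_sub_sigmoid_le {a t t' : ℝ} (ha : 0 < a)
    (h : (a ≤ t ∧ a ≤ t') ∨ (t ≤ -a ∧ t' ≤ -a)) :
    |Real.sigmoid t - Real.sigmoid t'| ≤ |t - t'| / (4 * a) := by
  -- Mean value inequality on a half-line avoiding the origin.
  have key : ∀ s : Set ℝ, Convex ℝ s → (∀ x ∈ s, a ≤ |x|) → t ∈ s → t' ∈ s →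
      |Real.sigmoid t - Real.sigmoid t'| ≤ |t - t'| / (4 * a) := by
    intro s hs hsa ht ht'
    have := hs.norm_image_sub_le_of_norm_hasDerivWithin_le (f := Real.sigmoid)
      (f' := fun x => Real.sigmoid x * (1 - Real.sigmoid x)) (C := 1 / (4 * a))
      (fun x _ => (Real.hasDerivAt_sigmoid x).hasDerivWithinAt) (fun x hx => ?_) ht' ht
    · rw [Real.norm_eq_abs, Real.norm_eq_abs] at this
      calc _ ≤ _ := this
        _ = _ := by ring
    · rw [Real.norm_of_nonneg]
      · exact Real.sigmoid_mul_one_sub_sigmoid_le ha (hsa x hx)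
      · exact mul_nonneg (Real.sigmoid_nonneg x) (by linarith [Real.sigmoid_le_one x])
  rcases h with h | h
  · exact key (Set.Ici a) (convex_Ici a) (fun x hx => (le_abs_self x).trans' hx) h.1 h.2
  · refine key (Set.Iic (-a)) (convex_Iic _) (fun x hx => ?_) h.1 h.2
    have : x ≤ -a := hx
    exact (neg_le_abs x).trans' (by linarith)

theorem Config.toVec_apply {N : ℕ} (x : Config N) (i : Fin N) :
    x.toVec i = ((x i : ℤ) : ℝ) := rfl

theorem abs_units_cast (s : ℤˣ) : |((s : ℤ) : ℝ)| = 1 := by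
  rcases Int.units_eq_one_or s with rfl | rfl <;> simp

theorem abs_units_cast_sub_le (s t : ℤˣ) : |((s : ℤ) : ℝ) - ((t : ℤ) : ℝ)| ≤ 2 := by
  rcases Int.units_eq_one_or s with rfl | rfl <;> rcases Int.units_eq_one_or t with rfl | rfl <;>
    norm_num

theorem sum_units_int {M : Type*} [AddCommMonoid M] (f : ℤˣ → M) : ∑ s, f s = f 1 + f (-1) := by
  have : (Finset.univ : Finset ℤˣ) = {1, -1} := by decide
  rw [this, Finset.sum_pair (by decide)]

/-! ### Conditional laws and Dobrushin's condition -/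

section GibbsCond

variable {N : ℕ} (β : ℝ) (W : Matrix (Fin N) (Fin N) ℝ) (h : Fin N → ℝ)

theorem gibbsWeight_pos (x : Config N) : 0 < gibbsWeight β W h x := Real.exp_pos _

theorem gibbsCond_pos (x : Config N) (i : Fin N) (s : ℤˣ) : 0 < gibbsCond β W h x i s :=
  div_pos (gibbsWeight_pos ..)
    (Finset.sum_pos (fun _ _ => gibbsWeight_pos ..) Finset.univ_nonempty)

theorem sum_gibbsCond (x : Config N) (i : Fin N) : ∑ s, gibbsCond β W h x i s = 1 := by
  unfold gibbsCond
  rw [← Finset.sum_div]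
  exact div_self (Finset.sum_pos (fun _ _ => gibbsWeight_pos ..) Finset.univ_nonempty).ne'

theorem gibbsCond_update_self (x : Config N) (i : Fin N) (s s' : ℤˣ) :
    gibbsCond β W h (Function.update x i s') i s = gibbsCond β W h x i s := by
  simp [gibbsCond]

/-- The effective field acting on the spin at `i`. -/
noncomputable def localField (x : Config N) (i : Fin N) : ℝ :=
  h i - β * ∑ k ∈ Finset.univ.erase i, W i k * x.toVec k

/-- `K` absorbs the diagonal term, constant because `s² = 1`; symmetry of `W` makes the two cross
terms equal, cancelling the factor `1 / 2`. -/
theorem gibbsWeight_update {W : Matrix (Fin N) (Fin N) ℝ} (hW : W.IsSymm) (x : Config N)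
    (i : Fin N) :
    ∃ K : ℝ, ∀ s : ℤˣ, gibbsWeight β W h (Function.update x i s) =
      K * Real.exp ((s : ℤ) * localField β W h x i) := by
  set z : Fin N → ℝ := Function.update x.toVec.ofLp i 0 with hz
  refine ⟨Real.exp (-(β / 2) * (z ⬝ᵥ (W *ᵥ z) + W i i) + z ⬝ᵥ h), fun s => ?_⟩
  have hv : (Config.toVec (Function.update x i s)).ofLp = z + Pi.single i ((s : ℤ) : ℝ) := by
    ext k
    rcases eq_or_ne k i with rfl | hk
    · simp [hz, Config.toVec]
    · simp [hz, Config.toVec, hk]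
  have hWz : (W *ᵥ z) i = ∑ k ∈ Finset.univ.erase i, W i k * x.toVec k := by
    rw [Matrix.mulVec, dotProduct, ← Finset.add_sum_erase _ _ (Finset.mem_univ i)]
    simp only [hz, Function.update_self, mul_zero, zero_add]
    exact Finset.sum_congr rfl fun k hk => by rw [Function.update_of_ne (Finset.ne_of_mem_erase hk)]
  have hs : ((s : ℤ) : ℝ) * ((s : ℤ) : ℝ) = 1 := by
    rcases Int.units_eq_one_or s with rfl | rfl <;> simp
  have hsymm : z ⬝ᵥ (W *ᵥ Pi.single i ((s : ℤ) : ℝ)) = ((s : ℤ) : ℝ) * (W *ᵥ z) i := by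
    rw [Matrix.dotProduct_mulVec, ← Matrix.mulVec_transpose, hW.eq]
    simp [mul_comm]
  have hdiag : Pi.single i ((s : ℤ) : ℝ) ⬝ᵥ (W *ᵥ Pi.single i ((s : ℤ) : ℝ)) = W i i := by
    simp only [single_dotProduct, Matrix.mulVec_single, Pi.smul_apply, Matrix.col_apply,
      MulOpposite.smul_eq_mul_unop, MulOpposite.unop_op]
    linear_combination W i i * hs
  rw [gibbsWeight, hv, ← Real.exp_add]
  congr 1
  rw [Matrix.mulVec_add, add_dotProduct, dotProduct_add, dotProduct_add, hsymm, hdiag,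
    add_dotProduct, single_dotProduct, single_dotProduct, localField, ← hWz]
  ring

theorem gibbsCond_one_eq_sigmoid {W : Matrix (Fin N) (Fin N) ℝ} (hW : W.IsSymm) (x : Config N)
    (i : Fin N) : gibbsCond β W h x i 1 = Real.sigmoid (2 * localField β W h x i) := by
  obtain ⟨K, hK⟩ := gibbsWeight_update β h hW x i
  have hK0 : K ≠ 0 := by
    intro h0
    have := gibbsWeight_pos β W h (Function.update x i 1)
    simp [hK, h0] at this
  rw [gibbsCond, sum_units_int, hK, hK, Real.sigmoid_def]
  set u := localField β W h x i
  have e : Real.exp (-(2 * u)) = Real.exp (-u) * Real.exp (-u) := by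
    rw [← Real.exp_add]; congr 1; ring
  have e1 : Real.exp u * Real.exp (-u) = 1 := by rw [← Real.exp_add]; simp
  have := Real.exp_pos u
  have := Real.exp_pos (-u)
  rw [e]
  simp only [Units.val_one, Int.cast_one, one_mul, Units.val_neg, Int.cast_neg, neg_mul]
  rw [← mul_add, mul_div_mul_left _ _ hK0]
  field_simp
  linear_combination Real.exp (-u) * e1

/-- Dobrushin's influence matrix: `R i j` bounds the effect of the spin at `j` on the conditional
law of the spin at `i`. -/
structure IsInfluenceBound (R : Matrix (Fin N) (Fin N) ℝ) : Prop where
  nonneg : ∀ i j, 0 ≤ R i j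
  bound : ∀ x i j s, i ≠ j →
    |gibbsCond β W h x i 1 - gibbsCond β W h (Function.update x j s) i 1| ≤ R i j
  row : ∀ i, ∑ j, R i j ≤ 1 / 2
  col : ∀ j, ∑ i, R i j ≤ 1 / 2

theorem fieldStrength_nonneg : 0 ≤ fieldStrength h := Real.iInf_nonneg fun _ => abs_nonneg _

theorem fieldStrength_le (i : Fin N) : fieldStrength h ≤ |h i| :=
  ciInf_le (Set.finite_range _).bddBelow i

variable {β W h}

theorem LargeField.sum_le (hβ : 0 ≤ β) (hL : LargeField β W h) (i : Fin N) :
    β * ∑ k ∈ Finset.univ.erase i, |W i k| ≤ fieldStrength h / 2 := by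
  have h1 : ∑ k ∈ Finset.univ.erase i, |W i k| ≤
      ⨆ i, ∑ k ∈ Finset.univ.erase i, |W i k| :=
    le_ciSup (f := fun i => ∑ k ∈ Finset.univ.erase i, |W i k|) (Set.finite_range _).bddAbove i
  have h2 := mul_le_mul_of_nonneg_left h1 hβ
  unfold LargeField at hL
  linarith

theorem abs_localField_sub_le (hβ : 0 ≤ β) (x : Config N) {i j : Fin N} (hij : i ≠ j) (s : ℤˣ) :
    |localField β W h x i - localField β W h (Function.update x j s) i| ≤ 2 * (β * |W i j|) := by
  have e : localField β W h x i - localField β W h (Function.update x j s) i =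
      β * (W i j * (((s : ℤ) : ℝ) - ((x j : ℤ) : ℝ))) := by
    have hj : j ∈ Finset.univ.erase i := by simp [hij.symm]
    have hsum : ∑ k ∈ (Finset.univ.erase i).erase j, W i k *
          Config.toVec (Function.update x j s) k =
        ∑ k ∈ (Finset.univ.erase i).erase j, W i k * x.toVec k :=
      Finset.sum_congr rfl fun k hk => by
        simp [Config.toVec_apply, Function.update_of_ne (Finset.ne_of_mem_erase hk)]
    rw [localField, localField, ← Finset.add_sum_erase _ _ hj, ← Finset.add_sum_erase _ _ hj, hsum]
    simp only [Config.toVec_apply, Function.update_self]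
    ring
  rw [e, abs_mul, abs_mul, abs_of_nonneg hβ]
  calc β * (|W i j| * |((s : ℤ) : ℝ) - ((x j : ℤ) : ℝ)|) ≤ β * (|W i j| * 2) := by
        gcongr; exact abs_units_cast_sub_le _ _
    _ = _ := by ring

theorem abs_localField_sub_field_le (hβ : 0 ≤ β) (hL : LargeField β W h) (x : Config N)
    (i : Fin N) : |localField β W h x i - h i| ≤ fieldStrength h / 2 := by
  refine le_trans ?_ (hL.sum_le hβ i)
  rw [localField, sub_sub_cancel_left, abs_neg, abs_mul, abs_of_nonneg hβ]
  gcongr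
  refine (Finset.abs_sum_le_sum_abs _ _).trans (Finset.sum_le_sum fun k _ => ?_)
  rw [abs_mul, Config.toVec_apply, abs_units_cast, mul_one]

/-- The sigmoid's argument is twice the local field: it stays at distance `≥ |h|` from `0` on one
side, and flipping spin `j` moves it by at most `4 β |W i j|`. -/
theorem LargeField.isInfluenceBound (hβ : 0 ≤ β) (hW : W.IsSymm) (hL : LargeField β W h) :
    IsInfluenceBound β W h
      (Matrix.of fun i j => if i = j then 0 else β * |W i j| / fieldStrength h) := by
  have ha := fieldStrength_nonneg h
  have hrow : ∀ i, ∑ j, (if i = j then 0 else β * |W i j| / fieldStrength h) ≤ 1 / 2 := by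
    intro i
    rw [← Finset.add_sum_erase _ _ (Finset.mem_univ i), if_pos rfl, zero_add,
      Finset.sum_congr (g := fun j => β * |W i j| / fieldStrength h) rfl fun j hj =>
        if_neg (Finset.ne_of_mem_erase hj).symm, ← Finset.sum_div, ← Finset.mul_sum]
    calc _ ≤ fieldStrength h / 2 / fieldStrength h := by gcongr; exact hL.sum_le hβ i
      _ = fieldStrength h / fieldStrength h / 2 := by ring
      _ ≤ 1 / 2 := by gcongr; exact div_self_le_one _
  refine ⟨fun i j => ?_, fun x i j s hij => ?_, hrow, fun j => ?_⟩
  · simp only [Matrix.of_apply]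
    split_ifs
    · exact le_rfl
    · positivity
  · simp only [Matrix.of_apply, if_neg hij]
    rw [gibbsCond_one_eq_sigmoid β h hW, gibbsCond_one_eq_sigmoid β h hW]
    have hd := abs_localField_sub_le (W := W) (h := h) hβ x hij s
    have h1 := abs_le.1 (abs_localField_sub_field_le hβ hL x i)
    have h2 := abs_le.1 (abs_localField_sub_field_le hβ hL (Function.update x j s) i)
    have hi := fieldStrength_le h i
    set u := localField β W h x i
    set u' := localField β W h (Function.update x j s) i
    -- At zero field strength the entries are `0` by the convention for division; there the
    -- interaction vanishes and both local fields equal `h i`.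
    rcases ha.eq_or_lt with h0 | hpos
    · have hu : u = h i := by linarith [h1.1, h1.2]
      have hu' : u' = h i := by linarith [h2.1, h2.2]
      rw [hu, hu', sub_self, abs_zero]
      positivity
    · refine (Real.abs_sigmoid_sub_sigmoid_le hpos ?_).trans ?_
      · rcases le_abs'.1 hi with h3 | h3
        · right; constructor <;> linarith [h1.2, h2.2]
        · left; constructor <;> linarith [h1.1, h2.1]
      · rw [← mul_sub, abs_mul, abs_two, div_le_div_iff₀ (by linarith) hpos]
        nlinarith
  · refine le_trans (le_of_eq (Finset.sum_congr rfl fun i _ => ?_)) (hrow j)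
    simp only [Matrix.of_apply, eq_comm (a := i), hW.apply]

end GibbsCond

/-! ### Discrete gradient and its two norms -/

section Gradient

variable {N : ℕ}

/-- The discrete gradient: `grad g i x` is the change of `g` when the spin at `i` is flipped. -/
noncomputable def grad : (Config N → ℝ) →ₗ[ℝ] Fin N → Config N → ℝ where
  toFun g i x := g (Function.update x i (-x i)) - g x
  map_add' f g := by
    ext i x
    simp only [Pi.add_apply]
    ring
  map_smul' c g := by
    ext i x
    simp only [Pi.smul_apply, smul_eq_mul, RingHom.id_apply]
    ring

theorem grad_apply (g : Config N → ℝ) (i : Fin N) (x : Config N) :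
    grad g i x = g (Function.update x i (-x i)) - g x := rfl

/-- The Lipschitz constant of `g` with respect to the Hamming distance. -/
noncomputable def lipInf (g : Config N → ℝ) : ℝ := ‖grad g‖

/-- The Euclidean norm of the vector of oscillations of `g` in the single coordinates. -/
noncomputable def lipTwo (g : Config N → ℝ) : ℝ := ‖WithLp.toLp 2 (grad g)‖

theorem lipInf_nonneg (g : Config N → ℝ) : 0 ≤ lipInf g := norm_nonneg _

theorem lipTwo_nonneg (g : Config N → ℝ) : 0 ≤ lipTwo g := norm_nonneg _

theorem lipInf_add_le (f g : Config N → ℝ) : lipInf (f + g) ≤ lipInf f + lipInf g := by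
  rw [lipInf, map_add]
  exact norm_add_le _ _

theorem lipTwo_add_le (f g : Config N → ℝ) : lipTwo (f + g) ≤ lipTwo f + lipTwo g := by
  rw [lipTwo, map_add, WithLp.toLp_add]
  exact norm_add_le _ _

theorem continuous_grad : Continuous (grad : (Config N → ℝ) → Fin N → Config N → ℝ) :=
  LinearMap.continuous_of_finiteDimensional _

theorem continuous_lipInf : Continuous (lipInf : (Config N → ℝ) → ℝ) := continuous_grad.norm

theorem continuous_lipTwo : Continuous (lipTwo : (Config N → ℝ) → ℝ) :=
  ((PiLp.continuous_toLp 2 _).comp continuous_grad).norm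

theorem lipTwo_sq (g : Config N → ℝ) : lipTwo g ^ 2 = ∑ i, ‖grad g i‖ ^ 2 := by
  rw [lipTwo, PiLp.norm_sq_eq_of_L2]

theorem lipTwo_eq (g : Config N → ℝ) :
    lipTwo g = ‖(WithLp.toLp 2 fun i => ‖grad g i‖ : EuclideanSpace ℝ (Fin N))‖ := by
  rw [lipTwo, PiLp.norm_eq_of_L2, PiLp.norm_eq_of_L2]
  simp

theorem norm_grad_apply_le (g : Config N → ℝ) (i : Fin N) : ‖grad g i‖ ≤ lipInf g :=
  norm_le_pi_norm (grad g) i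

theorem norm_grad_le {g : Config N → ℝ} {i : Fin N} {C : ℝ} (hC : 0 ≤ C)
    (h : ∀ x, |g (Function.update x i (-x i)) - g x| ≤ C) : ‖grad g i‖ ≤ C :=
  (pi_norm_le_iff_of_nonneg hC).2 h

theorem lipInf_le {g : Config N → ℝ} {C : ℝ} (hC : 0 ≤ C) (h : ∀ i, ‖grad g i‖ ≤ C) :
    lipInf g ≤ C :=
  (pi_norm_le_iff_of_nonneg hC).2 h

theorem abs_update_sub_le (g : Config N → ℝ) (x : Config N) (i : Fin N) (s : ℤˣ) :
    |g (Function.update x i s) - g x| ≤ ‖grad g i‖ := by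
  by_cases hs : s = x i
  · subst hs
    simp
  · rw [Int.units_ne_iff_eq_neg.1 hs]
    exact norm_le_pi_norm (grad g i) x

/-- Turn `y` into `x` one coordinate at a time. -/
theorem abs_sub_le_mul_lipInf (g : Config N → ℝ) (x y : Config N) :
    |g x - g y| ≤ N * lipInf g := by
  have key : ∀ s : Finset (Fin N), |g (s.piecewise x y) - g y| ≤ s.card * lipInf g := by
    intro s
    induction s using Finset.induction_on with
    | empty => simp
    | insert i s hi ih =>
      rw [Finset.piecewise_insert, Finset.card_insert_of_notMem hi]
      have h1 := (abs_update_sub_le g (s.piecewise x y) i (x i)).trans (norm_grad_apply_le g i)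
      have h2 := abs_add_le (g (Function.update (s.piecewise x y) i (x i)) - g (s.piecewise x y))
        (g (s.piecewise x y) - g y)
      rw [sub_add_sub_cancel] at h2
      push_cast
      linarith
  simpa using key Finset.univ

end Gradient

/-- Schur's test for a matrix whose absolute row and column sums are at most `1 / 2`. -/
theorem norm_transpose_mulVec_le {N : ℕ} {R : Matrix (Fin N) (Fin N) ℝ} (hR : ∀ i j, 0 ≤ R i j)
    (hrow : ∀ i, ∑ j, R i j ≤ 1 / 2) (hcol : ∀ j, ∑ i, R i j ≤ 1 / 2)
    (v : EuclideanSpace ℝ (Fin N)) :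
    ‖(WithLp.toLp 2 (Rᵀ *ᵥ v.ofLp) : EuclideanSpace ℝ (Fin N))‖ ≤ 1 / 2 * ‖v‖ := by
  refine le_of_sq_le_sq ?_ (by positivity)
  rw [mul_pow, EuclideanSpace.norm_sq_eq, EuclideanSpace.norm_sq_eq]
  simp only [Real.norm_eq_abs, sq_abs]
  -- Cauchy–Schwarz with weights `R i j`, then the column sum.
  have hj : ∀ j, ((Rᵀ *ᵥ v.ofLp) j) ^ 2 ≤ 1 / 2 * ∑ i, R i j * v i ^ 2 := by
    intro j
    have hcs := Finset.sum_mul_sq_le_sq_mul_sq Finset.univ (fun i => √(R i j))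
      (fun i => √(R i j) * v i)
    have e1 : ∀ i, √(R i j) * (√(R i j) * v i) = R i j * v i := fun i => by
      rw [← mul_assoc, Real.mul_self_sqrt (hR i j)]
    have e2 : ∀ i, √(R i j) ^ 2 = R i j := fun i => Real.sq_sqrt (hR i j)
    simp only [e1, mul_pow, e2] at hcs
    refine hcs.trans ?_
    gcongr
    · exact Finset.sum_nonneg fun i _ => mul_nonneg (hR i j) (sq_nonneg _)
    · exact hcol j
  calc ∑ j, ((Rᵀ *ᵥ v.ofLp) j) ^ 2 ≤ ∑ j, 1 / 2 * ∑ i, R i j * v i ^ 2 :=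
        Finset.sum_le_sum fun j _ => hj j
    _ = 1 / 2 * ∑ i, (∑ j, R i j) * v i ^ 2 := by
        rw [← Finset.mul_sum, Finset.sum_comm]
        simp only [Finset.sum_mul]
    _ ≤ 1 / 2 * ∑ i, 1 / 2 * v i ^ 2 := by
        gcongr with i
        exact hrow i
    _ = _ := by rw [← Finset.mul_sum]; ring

/-! ### Contraction and exponential moments for one Euler step -/

section Euler

variable {N : ℕ} (β : ℝ) (W : Matrix (Fin N) (Fin N) ℝ) (h : Fin N → ℝ)

/-- The conditional expectation given all spins but the one at `i`. -/
noncomputable def siteAvg (i : Fin N) (g : Config N → ℝ) (x : Config N) : ℝ :=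
  ∑ s : ℤˣ, gibbsCond β W h x i s * g (Function.update x i s)

theorem glauberGenerator_mulVec (g : Config N → ℝ) (x : Config N) :
    (glauberGenerator β W h *ᵥ g) x = ∑ i, (siteAvg β W h i g x - g x) := by
  simp only [Matrix.mulVec, dotProduct, glauberGenerator, Matrix.of_apply, Finset.sum_mul]
  rw [Finset.sum_comm]
  refine Finset.sum_congr rfl fun i _ => ?_
  simp only [sub_mul, Finset.sum_sub_distrib, Finset.sum_mul, siteAvg]
  congr 1
  · rw [Finset.sum_comm]
    simp
  · simp

theorem siteAvg_sub (i : Fin N) (g : Config N → ℝ) (x : Config N) :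
    siteAvg β W h i g x - g x =
      ∑ s, gibbsCond β W h x i s * (g (Function.update x i s) - g x) := by
  simp only [mul_sub, Finset.sum_sub_distrib, ← Finset.sum_mul, sum_gibbsCond, one_mul, siteAvg]

theorem siteAvg_mono (i : Fin N) {f g : Config N → ℝ} (hfg : f ≤ g) (x : Config N) :
    siteAvg β W h i f x ≤ siteAvg β W h i g x :=
  Finset.sum_le_sum fun _ _ => mul_le_mul_of_nonneg_left (hfg _) (gibbsCond_pos ..).le

/-- The Euler step `1 + L / m` for the Glauber semigroup. -/
noncomputable def eulerStep (m : ℕ) : Matrix (Config N) (Config N) ℝ :=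
  1 + (m : ℝ)⁻¹ • glauberGenerator β W h

theorem eulerStep_mulVec (m : ℕ) (g : Config N → ℝ) (x : Config N) :
    (eulerStep β W h m *ᵥ g) x = g x + (m : ℝ)⁻¹ * ∑ i, (siteAvg β W h i g x - g x) := by
  rw [eulerStep, Matrix.add_mulVec, Matrix.one_mulVec, Matrix.smul_mulVec, Pi.add_apply,
    Pi.smul_apply, smul_eq_mul, glauberGenerator_mulVec]

/-- For `N ≤ m` this is a convex combination of `g` and its site averages, so the step preserves
order. -/
theorem eulerStep_mulVec' (m : ℕ) (g : Config N → ℝ) (x : Config N) :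
    (eulerStep β W h m *ᵥ g) x =
      (1 - N * (m : ℝ)⁻¹) * g x + (m : ℝ)⁻¹ * ∑ i, siteAvg β W h i g x := by
  rw [eulerStep_mulVec, Finset.sum_sub_distrib]
  simp
  ring

theorem nat_mul_inv_le_one {m : ℕ} (hm : N ≤ m) : (N : ℝ) * (m : ℝ)⁻¹ ≤ 1 := by
  rw [← div_eq_mul_inv]
  exact div_le_one_of_le₀ (by exact_mod_cast hm) (by positivity)

theorem eulerStep_mulVec_mono {m : ℕ} (hm : N ≤ m) {f g : Config N → ℝ} (hfg : f ≤ g) :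
    eulerStep β W h m *ᵥ f ≤ eulerStep β W h m *ᵥ g := by
  intro x
  rw [eulerStep_mulVec', eulerStep_mulVec']
  have h1 := nat_mul_inv_le_one hm
  have h2 : 0 ≤ 1 - (N : ℝ) * (m : ℝ)⁻¹ := by linarith
  gcongr
  · exact hfg x
  · exact siteAvg_mono β W h _ hfg x

/-- A jump changes one spin, so `e^u ≤ 1 + u + u²` for `|u| ≤ 1` applies to the increment; summed
over sites, the squares give `lipTwo g ^ 2`. -/
theorem eulerStep_exp_le (m : ℕ) {g : Config N → ℝ} (hg : lipInf g ≤ 1) (x : Config N) :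
    (eulerStep β W h m *ᵥ fun y => Real.exp (g y)) x ≤
      Real.exp ((eulerStep β W h m *ᵥ g) x + (m : ℝ)⁻¹ * lipTwo g ^ 2) := by
  rw [eulerStep_mulVec, eulerStep_mulVec]
  have hi : ∀ i, siteAvg β W h i (fun y => Real.exp (g y)) x - Real.exp (g x) ≤
      Real.exp (g x) * (siteAvg β W h i g x - g x + ‖grad g i‖ ^ 2) := by
    intro i
    rw [siteAvg_sub, siteAvg_sub]
    calc _ ≤ ∑ s, gibbsCond β W h x i s * (Real.exp (g x) *
          (g (Function.update x i s) - g x + ‖grad g i‖ ^ 2)) := by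
          refine Finset.sum_le_sum fun s _ => mul_le_mul_of_nonneg_left ?_ (gibbsCond_pos ..).le
          have hd := abs_update_sub_le g x i s
          have hd1 := hd.trans ((norm_grad_apply_le g i).trans hg)
          have he := (abs_le.1 (Real.abs_exp_sub_one_sub_id_le hd1)).2
          have hsq : (g (Function.update x i s) - g x) ^ 2 ≤ ‖grad g i‖ ^ 2 :=
            sq_le_sq' (by linarith [(abs_le.1 hd).1]) (abs_le.1 hd).2
          have e : Real.exp (g (Function.update x i s)) =
              Real.exp (g x) * Real.exp (g (Function.update x i s) - g x) := by
            rw [← Real.exp_add]; congr 1; ring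
          rw [e]
          have := mul_le_mul_of_nonneg_left (a := Real.exp (g x)) (he.trans hsq)
            (Real.exp_pos _).le
          linarith
      _ = _ := by
          simp only [mul_add, mul_left_comm _ (Real.exp (g x)), Finset.sum_add_distrib,
            ← Finset.mul_sum, ← Finset.sum_mul, sum_gibbsCond, one_mul]
  have hsum := Finset.sum_le_sum fun i (_ : i ∈ Finset.univ) => hi i
  rw [← Finset.mul_sum, Finset.sum_add_distrib, ← lipTwo_sq] at hsum
  set S := ∑ i, (siteAvg β W h i g x - g x)
  calc _ ≤ Real.exp (g x) + (m : ℝ)⁻¹ * (Real.exp (g x) * (S + lipTwo g ^ 2)) := by gcongr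
    _ = Real.exp (g x) * ((m : ℝ)⁻¹ * (S + lipTwo g ^ 2) + 1) := by ring
    _ ≤ Real.exp (g x) * Real.exp ((m : ℝ)⁻¹ * (S + lipTwo g ^ 2)) := by
        gcongr; exact Real.add_one_le_exp _
    _ = _ := by rw [← Real.exp_add]; congr 1; ring

variable {β W h} {R : Matrix (Fin N) (Fin N) ℝ}

theorem abs_siteAvg_flip_sub_le (hR : IsInfluenceBound β W h R) (g : Config N → ℝ)
    (x : Config N) (i j : Fin N) :
    |siteAvg β W h i g (Function.update x j (-x j)) - siteAvg β W h i g x| ≤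
      (if i = j then 0 else ‖grad g j‖) + R i j * ‖grad g i‖ := by
  have hnn : 0 ≤ R i j * ‖grad g i‖ := mul_nonneg (hR.nonneg i j) (norm_nonneg _)
  split_ifs with hij
  · subst hij
    simpa [siteAvg, gibbsCond_update_self] using hnn
  · set y := Function.update x j (-x j)
    have hflip : ∀ s, Function.update y i s =
        Function.update (Function.update x i s) j (-(Function.update x i s) j) := fun s => by
      rw [Function.update_comm (Ne.symm hij), Function.update_of_ne (Ne.symm hij)]
    -- Split into the flip of `j` under a common law of spin `i`, and the change of that law.
    have e : siteAvg β W h i g y - siteAvg β W h i g x =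
        ∑ s, gibbsCond β W h y i s * grad g j (Function.update x i s) -
          (gibbsCond β W h x i 1 - gibbsCond β W h y i 1) *
            (g (Function.update x i 1) - g (Function.update x i (-1))) := by
      have h1 := sum_gibbsCond β W h x i
      have h2 := sum_gibbsCond β W h y i
      rw [sum_units_int] at h1 h2
      simp only [siteAvg, sum_units_int, grad_apply, ← hflip]
      linear_combination (h2 - h1) * g (Function.update x i (-1))
    have hA : |∑ s, gibbsCond β W h y i s * grad g j (Function.update x i s)| ≤ ‖grad g j‖ := by
      calc _ ≤ ∑ s, gibbsCond β W h y i s * ‖grad g j‖ := by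
            refine (Finset.abs_sum_le_sum_abs _ _).trans (Finset.sum_le_sum fun s _ => ?_)
            rw [abs_mul, abs_of_pos (gibbsCond_pos ..)]
            exact mul_le_mul_of_nonneg_left (norm_le_pi_norm (grad g j) _) (gibbsCond_pos ..).le
        _ = _ := by rw [← Finset.sum_mul, sum_gibbsCond, one_mul]
    have hB : |g (Function.update x i 1) - g (Function.update x i (-1))| ≤ ‖grad g i‖ := by
      simpa using abs_update_sub_le g (Function.update x i (-1)) i 1
    rw [e]
    refine (abs_sub _ _).trans (add_le_add hA ?_)
    rw [abs_mul]
    exact mul_le_mul (hR.bound x i j _ hij) hB (abs_nonneg _) (hR.nonneg i j)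

/-- Resampling at `j` itself erases the discrepancy there, which yields the gain `1 / m`; resampling
at `i ≠ j` spreads it at rate `R i j`. -/
theorem norm_grad_eulerStep_le (hR : IsInfluenceBound β W h R) {m : ℕ} (hm : N ≤ m)
    (g : Config N → ℝ) (j : Fin N) :
    ‖grad (eulerStep β W h m *ᵥ g) j‖ ≤
      (1 - (m : ℝ)⁻¹) * ‖grad g j‖ + (m : ℝ)⁻¹ * ∑ i, R i j * ‖grad g i‖ := by
  have h1 := nat_mul_inv_le_one hm
  have hN : 1 ≤ N := j.pos
  have hm1 : (m : ℝ)⁻¹ ≤ 1 := inv_le_one_of_one_le₀ (by exact_mod_cast hN.trans hm)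
  refine norm_grad_le ?_ fun x => ?_
  · refine add_nonneg (mul_nonneg (by linarith) (norm_nonneg _)) (mul_nonneg (by positivity) ?_)
    exact Finset.sum_nonneg fun i _ => mul_nonneg (hR.nonneg i j) (norm_nonneg _)
  · set y := Function.update x j (-x j)
    rw [eulerStep_mulVec', eulerStep_mulVec']
    have e : (1 - N * (m : ℝ)⁻¹) * g y + (m : ℝ)⁻¹ * ∑ i, siteAvg β W h i g y -
        ((1 - N * (m : ℝ)⁻¹) * g x + (m : ℝ)⁻¹ * ∑ i, siteAvg β W h i g x) =
        (1 - N * (m : ℝ)⁻¹) * (g y - g x) +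
          (m : ℝ)⁻¹ * ∑ i, (siteAvg β W h i g y - siteAvg β W h i g x) := by
      rw [Finset.sum_sub_distrib]; ring
    have hs : |∑ i, (siteAvg β W h i g y - siteAvg β W h i g x)| ≤
        ((N : ℝ) - 1) * ‖grad g j‖ + ∑ i, R i j * ‖grad g i‖ := by
      refine (Finset.abs_sum_le_sum_abs _ _).trans ((Finset.sum_le_sum fun i _ =>
        abs_siteAvg_flip_sub_le hR g x i j).trans (le_of_eq ?_))
      rw [Finset.sum_add_distrib, ← Finset.add_sum_erase _ _ (Finset.mem_univ j), if_pos rfl,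
        zero_add, Finset.sum_congr (g := fun _ => ‖grad g j‖) rfl fun i hi =>
          if_neg (Finset.ne_of_mem_erase hi)]
      simp [Nat.cast_sub hN]
    have hd : |g y - g x| ≤ ‖grad g j‖ := abs_update_sub_le g x j _
    rw [e]
    calc _ ≤ (1 - N * (m : ℝ)⁻¹) * |g y - g x| +
          (m : ℝ)⁻¹ * |∑ i, (siteAvg β W h i g y - siteAvg β W h i g x)| := by
          refine (abs_add_le _ _).trans (le_of_eq ?_)
          rw [abs_mul, abs_mul, abs_of_nonneg (by linarith : 0 ≤ 1 - (N : ℝ) * (m : ℝ)⁻¹),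
            abs_of_nonneg (by positivity : 0 ≤ (m : ℝ)⁻¹)]
      _ ≤ (1 - N * (m : ℝ)⁻¹) * ‖grad g j‖ +
          (m : ℝ)⁻¹ * (((N : ℝ) - 1) * ‖grad g j‖ + ∑ i, R i j * ‖grad g i‖) :=
          add_le_add (mul_le_mul_of_nonneg_left hd (by linarith))
            (mul_le_mul_of_nonneg_left hs (by positivity))
      _ = _ := by ring

theorem lipInf_eulerStep_le (hR : IsInfluenceBound β W h R) {m : ℕ} (hm : N ≤ m) (hm0 : 0 < m)
    (g : Config N → ℝ) :
    lipInf (eulerStep β W h m *ᵥ g) ≤ (1 - (m : ℝ)⁻¹ / 2) * lipInf g := by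
  have hm1 : (m : ℝ)⁻¹ ≤ 1 := inv_le_one_of_one_le₀ (by exact_mod_cast hm0)
  have h0 : 0 ≤ (m : ℝ)⁻¹ := by positivity
  have hl := lipInf_nonneg g
  refine lipInf_le (mul_nonneg (by linarith) hl) fun j =>
    (norm_grad_eulerStep_le hR hm g j).trans ?_
  have hs : ∑ i, R i j * ‖grad g i‖ ≤ 1 / 2 * lipInf g := by
    calc _ ≤ ∑ i, R i j * lipInf g := Finset.sum_le_sum fun i _ =>
          mul_le_mul_of_nonneg_left (norm_grad_apply_le g i) (hR.nonneg i j)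
      _ ≤ _ := by
          rw [← Finset.sum_mul]
          exact mul_le_mul_of_nonneg_right (hR.col j) hl
  calc _ ≤ (1 - (m : ℝ)⁻¹) * lipInf g + (m : ℝ)⁻¹ * (1 / 2 * lipInf g) :=
        add_le_add (mul_le_mul_of_nonneg_left (norm_grad_apply_le g j) (by linarith))
          (mul_le_mul_of_nonneg_left hs h0)
    _ = _ := by ring

theorem lipTwo_eulerStep_le (hR : IsInfluenceBound β W h R) {m : ℕ} (hm : N ≤ m) (hm0 : 0 < m)
    (g : Config N → ℝ) :
    lipTwo (eulerStep β W h m *ᵥ g) ≤ (1 - (m : ℝ)⁻¹ / 2) * lipTwo g := by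
  have hm1 : (m : ℝ)⁻¹ ≤ 1 := inv_le_one_of_one_le₀ (by exact_mod_cast hm0)
  have h0 : 0 ≤ (m : ℝ)⁻¹ := by positivity
  set v : EuclideanSpace ℝ (Fin N) := WithLp.toLp 2 fun i => ‖grad g i‖ with hv
  set w : EuclideanSpace ℝ (Fin N) := WithLp.toLp 2 (Rᵀ *ᵥ v.ofLp) with hw
  have hbound : lipTwo (eulerStep β W h m *ᵥ g) ≤ ‖(1 - (m : ℝ)⁻¹) • v + (m : ℝ)⁻¹ • w‖ := by
    refine le_of_sq_le_sq ?_ (norm_nonneg _)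
    rw [lipTwo_sq, EuclideanSpace.norm_sq_eq]
    refine Finset.sum_le_sum fun j _ => pow_le_pow_left₀ (norm_nonneg _) ?_ 2
    exact (norm_grad_eulerStep_le hR hm g j).trans (Real.le_norm_self _)
  have hsch := norm_transpose_mulVec_le hR.nonneg hR.row hR.col v
  calc _ ≤ _ := hbound
    _ ≤ (1 - (m : ℝ)⁻¹) * ‖v‖ + (m : ℝ)⁻¹ * ‖w‖ := by
        refine (norm_add_le _ _).trans (le_of_eq ?_)
        rw [norm_smul, norm_smul, Real.norm_of_nonneg h0, Real.norm_of_nonneg (by linarith)]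
    _ ≤ (1 - (m : ℝ)⁻¹) * ‖v‖ + (m : ℝ)⁻¹ * (1 / 2 * ‖v‖) := by gcongr
    _ = _ := by rw [lipTwo_eq]; ring

end Euler

/-! ### Passage to the semigroup; invariance of the Gibbs measure -/

section Semigroup

variable {N : ℕ} {β : ℝ} {W : Matrix (Fin N) (Fin N) ℝ} {h : Fin N → ℝ}
  {R : Matrix (Fin N) (Fin N) ℝ}

theorem le_pow_mul_of_contracting {F : (Config N → ℝ) → ℝ} {A : Matrix (Config N) (Config N) ℝ}
    {r : ℝ} (hr : 0 ≤ r) (hF : ∀ g, F (A *ᵥ g) ≤ r * F g) (g : Config N → ℝ) (k : ℕ) :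
    F (A ^ k *ᵥ g) ≤ r ^ k * F g := by
  induction k with
  | zero => simp
  | succ k ih =>
    rw [pow_succ', ← Matrix.mulVec_mulVec]
    calc _ ≤ r * F (A ^ k *ᵥ g) := hF _
      _ ≤ r * (r ^ k * F g) := by gcongr
      _ = _ := by ring

theorem one_sub_half_inv_nonneg {m : ℕ} (hm0 : 0 < m) : 0 ≤ 1 - (m : ℝ)⁻¹ / 2 := by
  have hm1 : (m : ℝ)⁻¹ ≤ 1 := inv_le_one_of_one_le₀ (by exact_mod_cast hm0)
  linarith

theorem one_sub_half_inv_le_one (m : ℕ) : 1 - (m : ℝ)⁻¹ / 2 ≤ 1 := by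
  have : 0 ≤ (m : ℝ)⁻¹ := by positivity
  linarith

theorem one_sub_half_inv_pow_le {m : ℕ} (hm0 : 0 < m) : (1 - (m : ℝ)⁻¹ / 2) ^ m ≤ 2 / 3 := by
  have hm : (m : ℝ) ≠ 0 := by exact_mod_cast hm0.ne'
  calc (1 - (m : ℝ)⁻¹ / 2) ^ m ≤ Real.exp (-((m : ℝ)⁻¹ / 2)) ^ m :=
        pow_le_pow_left₀ (one_sub_half_inv_nonneg hm0) (Real.one_sub_le_exp_neg _) m
    _ = (Real.exp (1 / 2))⁻¹ := by
        rw [← Real.exp_nat_mul, ← Real.exp_neg]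
        congr 1
        field_simp
    _ ≤ (3 / 2)⁻¹ := by
        gcongr
        have := Real.add_one_le_exp (1 / 2 : ℝ)
        linarith
    _ = 2 / 3 := by norm_num

/-- Contraction keeps every iterate within the range of the one-step bound. The decay of `lipTwo` is
not exploited: `k = m` steps cost `lipTwo g ^ 2`. -/
theorem eulerStep_pow_exp_le (hR : IsInfluenceBound β W h R) {m : ℕ} (hm : N ≤ m) (hm0 : 0 < m)
    {g : Config N → ℝ} (hg : lipInf g ≤ 1) (k : ℕ) (x : Config N) :
    (eulerStep β W h m ^ k *ᵥ fun y => Real.exp (g y)) x ≤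
      Real.exp ((eulerStep β W h m ^ k *ᵥ g) x + k * ((m : ℝ)⁻¹ * lipTwo g ^ 2)) := by
  induction k generalizing x with
  | zero => simp
  | succ k ih =>
    set Q := eulerStep β W h m
    have hr0 := one_sub_half_inv_nonneg hm0
    have hr1 : (1 - (m : ℝ)⁻¹ / 2) ^ k ≤ 1 := pow_le_one₀ hr0 (one_sub_half_inv_le_one m)
    have hinf : lipInf (Q ^ k *ᵥ g) ≤ 1 :=
      ((le_pow_mul_of_contracting hr0 (lipInf_eulerStep_le hR hm hm0) g k).trans
        (mul_le_of_le_one_left (lipInf_nonneg g) hr1)).trans hg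
    have htwo : lipTwo (Q ^ k *ᵥ g) ≤ lipTwo g :=
      (le_pow_mul_of_contracting hr0 (lipTwo_eulerStep_le hR hm hm0) g k).trans
        (mul_le_of_le_one_left (lipTwo_nonneg g) hr1)
    set c : ℝ := k * ((m : ℝ)⁻¹ * lipTwo g ^ 2)
    have e : (fun y => Real.exp ((Q ^ k *ᵥ g) y + c)) =
        Real.exp c • fun y => Real.exp ((Q ^ k *ᵥ g) y) := by
      ext y
      rw [Pi.smul_apply, smul_eq_mul, ← Real.exp_add, add_comm]
    rw [pow_succ', ← Matrix.mulVec_mulVec, ← Matrix.mulVec_mulVec]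
    calc _ ≤ (Q *ᵥ fun y => Real.exp ((Q ^ k *ᵥ g) y + c)) x :=
          eulerStep_mulVec_mono β W h hm (fun y => ih y) x
      _ = Real.exp c * (Q *ᵥ fun y => Real.exp ((Q ^ k *ᵥ g) y)) x := by
          rw [e, Matrix.mulVec_smul, Pi.smul_apply, smul_eq_mul]
      _ ≤ Real.exp c * Real.exp ((Q *ᵥ (Q ^ k *ᵥ g)) x +
          (m : ℝ)⁻¹ * lipTwo (Q ^ k *ᵥ g) ^ 2) := by
          gcongr
          exact eulerStep_exp_le β W h m hinf x
      _ ≤ Real.exp c * Real.exp ((Q *ᵥ (Q ^ k *ᵥ g)) x + (m : ℝ)⁻¹ * lipTwo g ^ 2) := by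
          have := lipTwo_nonneg (Q ^ k *ᵥ g)
          gcongr
      _ = _ := by
          rw [← Real.exp_add]
          congr 1
          simp only [c]
          push_cast
          ring

open Filter Topology in
theorem tendsto_eulerStep_pow_mulVec (β : ℝ) (W : Matrix (Fin N) (Fin N) ℝ) (h : Fin N → ℝ)
    (g : Config N → ℝ) :
    Tendsto (fun m : ℕ => eulerStep β W h m ^ m *ᵥ g) atTop
      (𝓝 (glauberSemigroup β W h 1 *ᵥ g)) := by
  have := Matrix.tendsto_one_add_smul_pow_exp (glauberGenerator β W h)
  rw [glauberSemigroup, one_smul]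
  exact ((Continuous.matrix_mulVec continuous_id continuous_const).tendsto _).comp this

open Filter in
theorem lipInf_glauberSemigroup_le (hR : IsInfluenceBound β W h R) (g : Config N → ℝ) :
    lipInf (glauberSemigroup β W h 1 *ᵥ g) ≤ 2 / 3 * lipInf g := by
  refine le_of_tendsto ((continuous_lipInf.tendsto _).comp
    (tendsto_eulerStep_pow_mulVec β W h g)) ?_
  filter_upwards [eventually_ge_atTop N, eventually_gt_atTop 0] with m hm hm0
  exact (le_pow_mul_of_contracting (one_sub_half_inv_nonneg hm0)
    (lipInf_eulerStep_le hR hm hm0) g m).trans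
    (mul_le_mul_of_nonneg_right (one_sub_half_inv_pow_le hm0) (lipInf_nonneg g))

open Filter in
theorem lipTwo_glauberSemigroup_le (hR : IsInfluenceBound β W h R) (g : Config N → ℝ) :
    lipTwo (glauberSemigroup β W h 1 *ᵥ g) ≤ 2 / 3 * lipTwo g := by
  refine le_of_tendsto ((continuous_lipTwo.tendsto _).comp
    (tendsto_eulerStep_pow_mulVec β W h g)) ?_
  filter_upwards [eventually_ge_atTop N, eventually_gt_atTop 0] with m hm hm0
  exact (le_pow_mul_of_contracting (one_sub_half_inv_nonneg hm0)
    (lipTwo_eulerStep_le hR hm hm0) g m).trans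
    (mul_le_mul_of_nonneg_right (one_sub_half_inv_pow_le hm0) (lipTwo_nonneg g))

open Filter in
/-- The transition kernel over a unit of time is sub-Gaussian. -/
theorem glauberSemigroup_exp_le (hR : IsInfluenceBound β W h R) {g : Config N → ℝ}
    (hg : lipInf g ≤ 1) (x : Config N) :
    (glauberSemigroup β W h 1 *ᵥ fun y => Real.exp (g y)) x ≤
      Real.exp ((glauberSemigroup β W h 1 *ᵥ g) x + lipTwo g ^ 2) := by
  have hl := ((continuous_apply x).tendsto _).comp
    (tendsto_eulerStep_pow_mulVec β W h fun y => Real.exp (g y))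
  have hr := ((continuous_apply x).tendsto _).comp (tendsto_eulerStep_pow_mulVec β W h g)
  refine le_of_tendsto_of_tendsto hl ((hr.add_const (lipTwo g ^ 2)).rexp) ?_
  filter_upwards [eventually_ge_atTop N, eventually_gt_atTop 0] with m hm hm0
  have := eulerStep_pow_exp_le hR hm hm0 hg m x
  rwa [mul_inv_cancel_left₀ (by exact_mod_cast hm0.ne')] at this

theorem gibbs_mul_gibbsCond_symm (x : Config N) (i : Fin N) (s : ℤˣ) :
    gibbs β W h x * gibbsCond β W h x i s =
      gibbs β W h (Function.update x i s) *
        gibbsCond β W h (Function.update x i s) i (x i) := by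
  simp only [gibbs, gibbsCond, Function.update_idem, Function.update_eq_self]
  ring

theorem sum_gibbs_mul_siteAvg (i : Fin N) (g : Config N → ℝ) :
    ∑ x, gibbs β W h x * siteAvg β W h i g x = ∑ x, gibbs β W h x * g x := by
  -- Exchanging the old and the new spin at `i` is an involution; detailed balance makes it preserve
  -- the joint weight.
  let σ : Config N × ℤˣ → Config N × ℤˣ := fun p => (Function.update p.1 i p.2, p.1 i)
  have hσ : Function.Involutive σ := fun p => by simp [σ]
  calc ∑ x, gibbs β W h x * siteAvg β W h i g x
      = ∑ p : Config N × ℤˣ, gibbs β W h p.1 * gibbsCond β W h p.1 i p.2 *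
          g (Function.update p.1 i p.2) := by
        rw [Fintype.sum_prod_type]
        simp only [siteAvg, Finset.mul_sum, mul_assoc]
    _ = ∑ p : Config N × ℤˣ, gibbs β W h p.1 * gibbsCond β W h p.1 i p.2 * g p.1 := by
        refine Fintype.sum_equiv hσ.toPerm _ _ fun p => ?_
        rw [gibbs_mul_gibbsCond_symm]
        rfl
    _ = _ := by
        rw [Fintype.sum_prod_type]
        refine Finset.sum_congr rfl fun x _ => ?_
        dsimp only
        rw [← Finset.sum_mul, ← Finset.mul_sum, sum_gibbsCond, mul_one]

theorem sum_gibbs_mul_eulerStep (m : ℕ) (g : Config N → ℝ) :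
    gibbs β W h ⬝ᵥ (eulerStep β W h m *ᵥ g) = gibbs β W h ⬝ᵥ g := by
  have hL : ∑ x, gibbs β W h x * ∑ i, (siteAvg β W h i g x - g x) = 0 := by
    simp only [Finset.mul_sum, mul_sub]
    rw [Finset.sum_comm]
    simp only [Finset.sum_sub_distrib, sum_gibbs_mul_siteAvg, sub_self, Finset.sum_const_zero]
  simp only [dotProduct, eulerStep_mulVec, mul_add, Finset.sum_add_distrib,
    mul_left_comm _ (m : ℝ)⁻¹, ← Finset.mul_sum, hL, mul_zero, add_zero]

/-- The Gibbs measure is invariant under the Glauber dynamics. -/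
theorem sum_gibbs_mul_glauberSemigroup (g : Config N → ℝ) :
    gibbs β W h ⬝ᵥ (glauberSemigroup β W h 1 *ᵥ g) = gibbs β W h ⬝ᵥ g := by
  have hpow : ∀ m k : ℕ, gibbs β W h ⬝ᵥ (eulerStep β W h m ^ k *ᵥ g) = gibbs β W h ⬝ᵥ g := by
    intro m k
    induction k with
    | zero => simp
    | succ k ih => rw [pow_succ', ← Matrix.mulVec_mulVec, sum_gibbs_mul_eulerStep, ih]
  have hc : Continuous fun f : Config N → ℝ => gibbs β W h ⬝ᵥ f :=
    Continuous.dotProduct continuous_const continuous_id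
  have hlim := (hc.tendsto _).comp (tendsto_eulerStep_pow_mulVec β W h g)
  simp only [Function.comp_def, hpow] at hlim
  exact tendsto_nhds_unique hlim tendsto_const_nhds |>.symm ▸ rfl

variable (β W h) in
theorem gibbs_pos (x : Config N) : 0 < gibbs β W h x :=
  div_pos (gibbsWeight_pos ..)
    (Finset.sum_pos (fun _ _ => gibbsWeight_pos ..) Finset.univ_nonempty)

variable (β W h) in
theorem sum_gibbs : ∑ x, gibbs β W h x = 1 := by
  unfold gibbs
  rw [← Finset.sum_div]
  exact div_self (Finset.sum_pos (fun _ _ => gibbsWeight_pos ..) Finset.univ_nonempty).ne'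

theorem le_mul_lipInf_of_gibbs_eq_zero {g : Config N → ℝ} (hg : gibbs β W h ⬝ᵥ g = 0)
    (x : Config N) : g x ≤ N * lipInf g := by
  have e : g x = ∑ y, gibbs β W h y * (g x - g y) := by
    simp only [mul_sub, Finset.sum_sub_distrib, ← Finset.sum_mul, sum_gibbs, one_mul]
    rw [dotProduct] at hg
    rw [hg, sub_zero]
  rw [e]
  calc _ ≤ ∑ y, gibbs β W h y * (N * lipInf g) := Finset.sum_le_sum fun y _ =>
        mul_le_mul_of_nonneg_left ((le_abs_self _).trans (abs_sub_le_mul_lipInf g x y))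
          (gibbs_pos ..).le
    _ = _ := by rw [← Finset.sum_mul, sum_gibbs, one_mul]

end Semigroup

/-! ### Integrals of finitely valued functions -/

section FiniteRange

open MeasureTheory

theorem comp_eq_sum_indicator {Ω T : Type*} [Fintype T] {Y : Ω → T} (F : T → ℝ) :
    (fun ω => F (Y ω)) = fun ω => ∑ t, {ω | Y ω = t}.indicator (fun _ => F t) ω := by
  classical
  ext ω
  simp [Set.indicator_apply]

variable {Ω T : Type*} [MeasurableSpace Ω] [Fintype T] {μ : Measure Ω} {Y : Ω → T}

theorem integrable_comp_of_fintype [IsFiniteMeasure μ] (hY : ∀ t, MeasurableSet {ω | Y ω = t})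
    (F : T → ℝ) : Integrable (fun ω => F (Y ω)) μ := by
  rw [comp_eq_sum_indicator]
  exact integrable_finsetSum _ fun t _ => (integrable_const _).indicator (hY t)

theorem integral_comp_of_fintype [IsFiniteMeasure μ] (hY : ∀ t, MeasurableSet {ω | Y ω = t})
    (F : T → ℝ) : ∫ ω, F (Y ω) ∂μ = ∑ t, μ.real {ω | Y ω = t} * F t := by
  rw [comp_eq_sum_indicator,
    integral_finsetSum _ fun t _ => (integrable_const _).indicator (hY t)]
  refine Finset.sum_congr rfl fun t _ => ?_
  rw [integral_indicator_const _ (hY t), smul_eq_mul]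

end FiniteRange

/-! ### Exponential moments along the chain -/

section Chain

open MeasureTheory

variable {N : ℕ} {β : ℝ} {W : Matrix (Fin N) (Fin N) ℝ} {h : Fin N → ℝ} {q : Config N → ℝ}
  {n : ℕ} {Ω : Type*} [MeasurableSpace Ω] {μ : Measure Ω} {X : ℕ → Ω → Config N}

/-- The first `m` samples as a vector. -/
def samplePath (X : ℕ → Ω → Config N) (m : ℕ) (ω : Ω) : Fin m → Config N := fun i => X i ω

theorem IsGlauberSample.measurableSet_samplePath (hX : IsGlauberSample β W h q n μ X) {m : ℕ}
    (hm : m ≤ n) (a : Fin m → Config N) : MeasurableSet {ω | samplePath X m ω = a} := by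
  have : {ω | samplePath X m ω = a} = ⋂ i : Fin m, {ω | X i ω = a i} := by
    ext ω
    simp [samplePath, funext_iff]
  rw [this]
  exact MeasurableSet.iInter fun i => hX.measurable i (i.2.trans_le hm) _

theorem IsGlauberSample.real_samplePath_snoc (hX : IsGlauberSample β W h q n μ X) {m : ℕ}
    (hm : m + 1 < n) (a : Fin (m + 1) → Config N) (y : Config N) :
    μ.real {ω | samplePath X (m + 2) ω = Fin.snoc (α := fun _ => Config N) a y} =
      μ.real {ω | samplePath X (m + 1) ω = a} *
        glauberSemigroup β W h 1 (a (Fin.last m)) y := by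
  let b : ℕ → Config N := fun i => if hi : i < m + 1 then a ⟨i, hi⟩ else y
  have e1 : {ω | samplePath X (m + 1) ω = a} = {ω | ∀ i ≤ m, X i ω = b i} := by
    ext ω
    simp only [Set.mem_ofPred_eq, funext_iff, Fin.forall_iff, samplePath, Nat.lt_succ_iff]
    refine forall₂_congr fun i hi => ?_
    rw [show b i = a ⟨i, Nat.lt_succ_iff.2 hi⟩ from dif_pos _]
  have e2 : {ω | samplePath X (m + 2) ω = Fin.snoc (α := fun _ => Config N) a y} =
      {ω | ∀ i ≤ m + 1, X i ω = b i} := by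
    have hb : Fin.snoc (α := fun _ => Config N) a y = fun i : Fin (m + 2) => b i := rfl
    ext ω
    rw [hb]
    exact ⟨fun H i hi => congrFun H ⟨i, Nat.lt_succ_iff.2 hi⟩,
      fun H => funext fun i => H i (Nat.lt_succ_iff.1 i.2)⟩
  rw [e1, e2, hX.law _ hm, hX.law _ (by omega), Finset.prod_range_succ, ← mul_assoc,
    show b m = a (Fin.last m) from dif_pos (Nat.lt_succ_self m),
    show b (m + 1) = y from dif_neg (lt_irrefl _)]

variable [IsProbabilityMeasure μ]

theorem IsGlauberSample.integrable (hX : IsGlauberSample β W h q n μ X) {m : ℕ} (hm : m < n)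
    (f φ : Config N → ℝ) :
    Integrable (fun ω => Real.exp (∑ i ∈ Finset.range m, f (X i ω)) * φ (X m ω)) μ := by
  have := integrable_comp_of_fintype (μ := μ) (hX.measurableSet_samplePath (m := m + 1) hm)
    fun a => Real.exp (∑ i : Fin m, f (a i.castSucc)) * φ (a (Fin.last m))
  simpa [samplePath, Finset.sum_range] using this

/-- The Markov property. -/
theorem IsGlauberSample.integral_succ (hX : IsGlauberSample β W h q n μ X) {m : ℕ}
    (hm : m + 1 < n) (f φ : Config N → ℝ) :
    ∫ ω, Real.exp (∑ i ∈ Finset.range (m + 1), f (X i ω)) * φ (X (m + 1) ω) ∂μ =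
      ∫ ω, Real.exp (∑ i ∈ Finset.range m, f (X i ω)) *
        (Real.exp (f (X m ω)) * (glauberSemigroup β W h 1 *ᵥ φ) (X m ω)) ∂μ := by
  have h2 := integral_comp_of_fintype (μ := μ) (hX.measurableSet_samplePath (m := m + 2) hm)
    fun a => Real.exp (∑ i : Fin (m + 1), f (a i.castSucc)) * φ (a (Fin.last (m + 1)))
  have h1 := integral_comp_of_fintype (μ := μ)
    (hX.measurableSet_samplePath (m := m + 1) (by omega))
    fun a => Real.exp (∑ i : Fin m, f (a i.castSucc)) *
      (Real.exp (f (a (Fin.last m))) * (glauberSemigroup β W h 1 *ᵥ φ) (a (Fin.last m)))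
  have e2 : ∀ ω, Real.exp (∑ i ∈ Finset.range (m + 1), f (X i ω)) * φ (X (m + 1) ω) =
      Real.exp (∑ i : Fin (m + 1), f (samplePath X (m + 2) ω i.castSucc)) *
        φ (samplePath X (m + 2) ω (Fin.last (m + 1))) := fun ω => by
    simp [samplePath, Finset.sum_range]
  have e1 : ∀ ω, Real.exp (∑ i ∈ Finset.range m, f (X i ω)) *
        (Real.exp (f (X m ω)) * (glauberSemigroup β W h 1 *ᵥ φ) (X m ω)) =
      Real.exp (∑ i : Fin m, f (samplePath X (m + 1) ω i.castSucc)) *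
        (Real.exp (f (samplePath X (m + 1) ω (Fin.last m))) *
          (glauberSemigroup β W h 1 *ᵥ φ) (samplePath X (m + 1) ω (Fin.last m))) := fun ω => by
    simp [samplePath, Finset.sum_range]
  simp only [e1, e2, h1, h2]
  -- Split a path into its last state and the preceding ones, then sum out the last state.
  rw [← (Fin.snocEquiv fun _ : Fin (m + 2) => Config N).sum_comp, Fintype.sum_prod_type_right]
  refine Finset.sum_congr rfl fun a _ => ?_
  have hs : ∀ y, (Fin.snocEquiv fun _ : Fin (m + 2) => Config N) (y, a) =
    Fin.snoc (α := fun _ => Config N) a y := fun _ => rfl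
  simp only [hs, hX.real_samplePath_snoc hm, Fin.snoc_castSucc, Fin.snoc_last]
  rw [Fin.sum_univ_castSucc, Real.exp_add, Matrix.mulVec, dotProduct]
  simp only [Finset.mul_sum]
  exact Finset.sum_congr rfl fun y _ => by ring

/-- Each backward step replaces `g` by `f + P g` at cost `B²`, preserving the bounds `1 = 1/3 + 2/3`
and `B = B/3 + 2B/3`. Zero Gibbs mean also persists, and bounds the remaining initial term by `e^N`
whatever the initial law. -/
theorem IsGlauberSample.integral_exp_le_aux {R : Matrix (Fin N) (Fin N) ℝ}
    (hR : IsInfluenceBound β W h R) (hX : IsGlauberSample β W h q n μ X) {f : Config N → ℝ}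
    {B : ℝ} (hf : gibbs β W h ⬝ᵥ f = 0) (hf1 : lipInf f ≤ 1 / 3) (hf2 : lipTwo f ≤ B / 3)
    {m : ℕ} (hm : m < n) {g : Config N → ℝ} (hg : gibbs β W h ⬝ᵥ g = 0) (hg1 : lipInf g ≤ 1)
    (hg2 : lipTwo g ≤ B) :
    ∫ ω, Real.exp (∑ i ∈ Finset.range m, f (X i ω)) * Real.exp (g (X m ω)) ∂μ ≤
      Real.exp (N + m * B ^ 2) := by
  induction m generalizing g with
  | zero =>
    have hint := hX.integrable hm f fun x => Real.exp (g x)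
    calc _ ≤ ∫ _, Real.exp N ∂μ := by
          refine integral_mono hint (integrable_const _) fun ω => ?_
          simp only [Finset.range_zero, Finset.sum_empty, Real.exp_zero, one_mul]
          gcongr
          exact (le_mul_lipInf_of_gibbs_eq_zero hg _).trans
            (mul_le_of_le_one_right (by positivity) hg1)
      _ = _ := by simp
  | succ m ih =>
    set P := glauberSemigroup β W h 1
    have hinf := lipInf_glauberSemigroup_le hR g
    have htwo := lipTwo_glauberSemigroup_le hR g
    have key := ih (by omega) (g := f + P *ᵥ g)
      (by rw [dotProduct_add, sum_gibbs_mul_glauberSemigroup, hf, hg, add_zero])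
      ((lipInf_add_le _ _).trans (by linarith)) ((lipTwo_add_le _ _).trans (by linarith))
    have hsq : lipTwo g ^ 2 ≤ B ^ 2 := pow_le_pow_left₀ (lipTwo_nonneg g) hg2 2
    rw [hX.integral_succ hm f fun x => Real.exp (g x)]
    calc _ ≤ ∫ ω, Real.exp (∑ i ∈ Finset.range m, f (X i ω)) *
          (Real.exp (B ^ 2) * Real.exp ((f + P *ᵥ g) (X m ω))) ∂μ := by
          refine integral_mono
            (hX.integrable (by omega) f fun x => Real.exp (f x) * (P *ᵥ fun y => Real.exp (g y)) x)
            (hX.integrable (by omega) f fun x => Real.exp (B ^ 2) * Real.exp ((f + P *ᵥ g) x))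
            fun ω => ?_
          refine mul_le_mul_of_nonneg_left ?_ (Real.exp_pos _).le
          have h1 := glauberSemigroup_exp_le hR hg1 (X m ω)
          calc _ ≤ Real.exp (f (X m ω)) * Real.exp ((P *ᵥ g) (X m ω) + lipTwo g ^ 2) :=
                mul_le_mul_of_nonneg_left h1 (Real.exp_pos _).le
            _ ≤ Real.exp (f (X m ω)) * Real.exp ((P *ᵥ g) (X m ω) + B ^ 2) := by gcongr
            _ = _ := by
              rw [← Real.exp_add, ← Real.exp_add, Pi.add_apply]
              congr 1
              ring
      _ = Real.exp (B ^ 2) * ∫ ω, Real.exp (∑ i ∈ Finset.range m, f (X i ω)) *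
          Real.exp ((f + P *ᵥ g) (X m ω)) ∂μ := by
          rw [← integral_const_mul]
          congr 1
          ext ω
          ring
      _ ≤ Real.exp (B ^ 2) * Real.exp (N + m * B ^ 2) := by gcongr
      _ = _ := by
          rw [← Real.exp_add]
          congr 1
          push_cast
          ring

theorem IsGlauberSample.integral_exp_sum_le {R : Matrix (Fin N) (Fin N) ℝ}
    (hR : IsInfluenceBound β W h R) (hX : IsGlauberSample β W h q n μ X) (hn : 0 < n)
    {f : Config N → ℝ} {B : ℝ} (hf : gibbs β W h ⬝ᵥ f = 0) (hf1 : lipInf f ≤ 1 / 3)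
    (hf2 : lipTwo f ≤ B / 3) :
    ∫ ω, Real.exp (∑ i ∈ Finset.range n, f (X i ω)) ∂μ ≤ Real.exp (N + n * B ^ 2) := by
  obtain ⟨m, rfl⟩ : ∃ m, n = m + 1 := ⟨n - 1, by omega⟩
  have h0 := lipTwo_nonneg f
  have key := hX.integral_exp_le_aux hR hf hf1 hf2 (Nat.lt_succ_self m) hf (by linarith)
    (by linarith)
  have e : ∀ ω, Real.exp (∑ i ∈ Finset.range (m + 1), f (X i ω)) =
      Real.exp (∑ i ∈ Finset.range m, f (X i ω)) * Real.exp (f (X m ω)) := fun ω => by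
    rw [Finset.sum_range_succ, Real.exp_add]
  simp only [e]
  refine key.trans ?_
  gcongr
  omega

theorem IsGlauberSample.integrable_exp_sum (hX : IsGlauberSample β W h q n μ X)
    (f : Config N → ℝ) : Integrable (fun ω => Real.exp (∑ i ∈ Finset.range n, f (X i ω))) μ := by
  have := integrable_comp_of_fintype (μ := μ) (hX.measurableSet_samplePath (m := n) le_rfl)
    fun a => Real.exp (∑ i, f (a i))
  simpa [samplePath, Finset.sum_range] using this

end Chain

/-! ### Linear observables and Chernoff's bound -/

section Linear

open MeasureTheory

variable {N : ℕ} {β : ℝ} {W : Matrix (Fin N) (Fin N) ℝ} {h : Fin N → ℝ}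

theorem gibbsMean_apply (i : Fin N) :
    gibbsMean β W h i = ∑ x, gibbs β W h x * x.toVec i := by
  simp [gibbsMean]

theorem abs_gibbsMean_le (i : Fin N) : |gibbsMean β W h i| ≤ 1 := by
  rw [gibbsMean_apply, ← sum_gibbs β W h]
  refine (Finset.abs_sum_le_sum_abs _ _).trans (Finset.sum_le_sum fun x _ => ?_)
  rw [abs_mul, Config.toVec_apply, abs_units_cast, mul_one, abs_of_pos (gibbs_pos ..)]

variable (β W h) in
/-- The centered linear function `x ↦ ⟨η, x - E_ν[X]⟩`. -/
noncomputable def centeredLinear (η : Fin N → ℝ) (x : Config N) : ℝ :=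
  ∑ i, η i * (x.toVec i - gibbsMean β W h i)

theorem gibbs_dotProduct_centeredLinear (η : Fin N → ℝ) :
    gibbs β W h ⬝ᵥ centeredLinear β W h η = 0 := by
  simp only [dotProduct, centeredLinear, Finset.mul_sum]
  rw [Finset.sum_comm]
  refine Finset.sum_eq_zero fun i _ => ?_
  simp only [mul_left_comm _ (η i), ← Finset.mul_sum, mul_sub, Finset.sum_sub_distrib,
    ← Finset.sum_mul, sum_gibbs, ← gibbsMean_apply, one_mul, sub_self]

theorem norm_grad_centeredLinear_le (η : Fin N → ℝ) (i : Fin N) :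
    ‖grad (centeredLinear β W h η) i‖ ≤ 2 * |η i| := by
  refine norm_grad_le (by positivity) fun x => ?_
  have e : centeredLinear β W h η (Function.update x i (-x i)) - centeredLinear β W h η x =
      η i * (((-x i : ℤˣ) : ℤ) - (x i : ℤ) : ℝ) := by
    rw [centeredLinear, centeredLinear, ← Finset.sum_sub_distrib,
      Finset.sum_eq_single i (fun j _ hj => ?_) (by simp)]
    · simp only [Config.toVec_apply, Function.update_self]
      ring
    · simp only [Config.toVec_apply, Function.update_of_ne hj, sub_self]
  rw [e, abs_mul, mul_comm]
  gcongr
  exact abs_units_cast_sub_le _ _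

theorem lipTwo_centeredLinear_le (η : Fin N → ℝ) {C : ℝ} (hC : 0 ≤ C)
    (hη : ∑ i, η i ^ 2 ≤ C ^ 2) : lipTwo (centeredLinear β W h η) ≤ 2 * C := by
  refine le_of_sq_le_sq ?_ (by positivity)
  rw [lipTwo_sq]
  calc _ ≤ ∑ i, (2 * |η i|) ^ 2 := Finset.sum_le_sum fun i _ =>
        pow_le_pow_left₀ (norm_nonneg _) (norm_grad_centeredLinear_le η i) 2
    _ = 4 * ∑ i, η i ^ 2 := by
        rw [Finset.mul_sum]
        exact Finset.sum_congr rfl fun i _ => by rw [mul_pow, sq_abs]; norm_num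
    _ ≤ (2 * C) ^ 2 := by linarith [mul_pow 2 C 2]

/-- Discarding the coefficients which exceed `1 / 6` changes a centered linear function by a
bounded amount. -/
theorem centeredLinear_le_truncated (η : Fin N → ℝ) (x : Config N) :
    centeredLinear β W h η x ≤
      centeredLinear β W h (fun i => if |η i| ≤ 1 / 6 then η i else 0) x +
        12 * ∑ i, η i ^ 2 := by
  rw [centeredLinear, centeredLinear, Finset.mul_sum, ← Finset.sum_add_distrib]
  refine Finset.sum_le_sum fun i _ => ?_
  split_ifs with hi
  · have := sq_nonneg (η i)
    linarith
  · have h1 : |x.toVec i - gibbsMean β W h i| ≤ 2 := by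
      refine (abs_sub _ _).trans ?_
      have := abs_gibbsMean_le (β := β) (W := W) (h := h) i
      rw [Config.toVec_apply, abs_units_cast]
      linarith
    have h2 : |η i * (x.toVec i - gibbsMean β W h i)| ≤ |η i| * 2 := by
      rw [abs_mul]
      gcongr
    have h3 := le_abs_self (η i * (x.toVec i - gibbsMean β W h i))
    push Not at hi
    nlinarith [sq_abs (η i)]

theorem sum_centeredLinear_eq {Ω : Type*} (X : ℕ → Ω → Config N) {n : ℕ}
    (hn : 0 < n) (l : ℝ) (θ : EuclideanSpace ℝ (Fin N)) (ω : Ω) :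
    ∑ t ∈ Finset.range n, centeredLinear β W h (fun i => l * θ i) (X t ω) =
      l * (n * inner ℝ θ (((1 / (n : ℝ)) • ∑ i ∈ Finset.range n, (X i ω).toVec) -
        gibbsMean β W h)) := by
  have hn0 : (n : ℝ) ≠ 0 := by exact_mod_cast hn.ne'
  have e : ∀ x, centeredLinear β W h (fun i => l * θ i) x =
      l * inner ℝ θ (x.toVec - gibbsMean β W h) := fun x => by
    rw [centeredLinear, PiLp.inner_apply, Finset.mul_sum]
    refine Finset.sum_congr rfl fun i _ => ?_
    simp only [PiLp.sub_apply, RCLike.inner_apply, conj_trivial]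
    ring
  simp only [e, ← Finset.mul_sum, inner_sub_right, Finset.sum_sub_distrib, inner_smul_right,
    inner_sum, Finset.sum_const, Finset.card_range, nsmul_eq_mul]
  field_simp

variable {q : Config N → ℝ} {n : ℕ} {Ω : Type*} [MeasurableSpace Ω] {μ : Measure Ω}
  [IsProbabilityMeasure μ] {X : ℕ → Ω → Config N}

/-- The moment generating function of a linear functional of the empirical sum. -/
theorem IsGlauberSample.integral_exp_centeredLinear_le {R : Matrix (Fin N) (Fin N) ℝ}
    (hR : IsInfluenceBound β W h R) (hX : IsGlauberSample β W h q n μ X) (hn : 0 < n)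
    {η : Fin N → ℝ} {C : ℝ} (hC : 0 ≤ C) (hη : ∑ i, η i ^ 2 ≤ C ^ 2) :
    ∫ ω, Real.exp (∑ t ∈ Finset.range n, centeredLinear β W h η (X t ω)) ∂μ ≤
      Real.exp (N + 48 * (n * C ^ 2)) := by
  -- A spin flip changes a coordinate by `2`, so the threshold `1 / 6` gives `lipInf ≤ 1 / 3`. With
  -- `B = 6 C` the total is `36 + 12 = 48`.
  set ζ : Fin N → ℝ := fun i => if |η i| ≤ 1 / 6 then η i else 0 with hζ
  have hζ1 : ∀ i, |ζ i| ≤ 1 / 6 := fun i => by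
    simp only [hζ]
    split_ifs with hi
    · exact hi
    · norm_num
  have hζ2 : ∑ i, ζ i ^ 2 ≤ C ^ 2 := by
    refine (Finset.sum_le_sum fun i _ => ?_).trans hη
    simp only [hζ]
    split_ifs
    · exact le_rfl
    · simpa using sq_nonneg (η i)
  have hinf : lipInf (centeredLinear β W h ζ) ≤ 1 / 3 :=
    lipInf_le (by norm_num) fun i =>
      (norm_grad_centeredLinear_le ζ i).trans (by linarith [hζ1 i])
  have htwo : lipTwo (centeredLinear β W h ζ) ≤ 6 * C / 3 :=
    (lipTwo_centeredLinear_le ζ hC hζ2).trans (by linarith)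
  have key := hX.integral_exp_sum_le hR hn (gibbs_dotProduct_centeredLinear ζ) hinf htwo
  calc _ ≤ ∫ ω, Real.exp (n * (12 * C ^ 2)) *
        Real.exp (∑ t ∈ Finset.range n, centeredLinear β W h ζ (X t ω)) ∂μ := by
        refine integral_mono (hX.integrable_exp_sum _)
          ((hX.integrable_exp_sum _).const_mul _) fun ω => ?_
        dsimp only
        rw [← Real.exp_add]
        gcongr
        calc _ ≤ ∑ t ∈ Finset.range n, (centeredLinear β W h ζ (X t ω) + 12 * C ^ 2) :=
              Finset.sum_le_sum fun t _ =>
                (centeredLinear_le_truncated η (X t ω)).trans (by linarith)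
          _ = _ := by
              rw [Finset.sum_add_distrib, Finset.sum_const, Finset.card_range, nsmul_eq_mul]
              ring
    _ = Real.exp (n * (12 * C ^ 2)) *
        ∫ ω, Real.exp (∑ t ∈ Finset.range n, centeredLinear β W h ζ (X t ω)) ∂μ :=
        integral_const_mul _ _
    _ ≤ Real.exp (n * (12 * C ^ 2)) * Real.exp (N + n * (6 * C) ^ 2) := by gcongr
    _ = _ := by
        rw [← Real.exp_add]
        congr 1
        ring

/-- The Chernoff bound in a fixed direction. -/
theorem IsGlauberSample.real_inner_ge_le {R : Matrix (Fin N) (Fin N) ℝ}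
    (hR : IsInfluenceBound β W h R) (hX : IsGlauberSample β W h q n μ X) (hn : 0 < n)
    {θ : EuclideanSpace ℝ (Fin N)} (hθ : ‖θ‖ = 1) {ε : ℝ} (hε : 0 < ε) :
    μ.real {ω | ε / 2 ≤ inner ℝ θ (((1 / (n : ℝ)) • ∑ i ∈ Finset.range n, (X i ω).toVec) -
      gibbsMean β W h)} ≤ Real.exp (N - n * ε ^ 2 / 768) := by
  -- The minimizer of `48 n l² - n l ε / 2`, with minimum `-n ε² / 768`.
  set l : ℝ := ε / 192 with hl
  have hl0 : 0 < l := by positivity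
  have hn0 : (0 : ℝ) < n := by exact_mod_cast hn
  have hη : ∑ i, (l * θ i) ^ 2 ≤ l ^ 2 := by
    have h1 := EuclideanSpace.norm_sq_eq θ
    simp only [hθ, Real.norm_eq_abs, sq_abs, one_pow] at h1
    simp only [mul_pow, ← Finset.mul_sum, ← h1, mul_one, le_refl]
  have hmgf := hX.integral_exp_centeredLinear_le hR hn hl0.le hη
  have hint := hX.integrable_exp_sum (centeredLinear β W h fun i => l * θ i)
  have hmk := mul_meas_ge_le_integral_of_nonneg (μ := μ)
    (Filter.Eventually.of_forall fun ω => (Real.exp_pos _).le) hint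
    (Real.exp (l * (n * (ε / 2))))
  simp only [sum_centeredLinear_eq X hn, Real.exp_le_exp, mul_le_mul_iff_right₀ hl0,
    mul_le_mul_iff_right₀ hn0] at hmk hmgf
  have h2 := hmk.trans hmgf
  rw [← le_div_iff₀' (Real.exp_pos _), ← Real.exp_sub] at h2
  refine h2.trans (le_of_eq ?_)
  congr 1
  rw [hl]
  ring

end Linear

/-! ### Union bound over a net of the sphere -/

theorem gammaGap_le_one {N : ℕ} (h : Fin N → ℝ) : gammaGap h ≤ 1 := by
  have := fieldStrength_nonneg h
  unfold gammaGap
  have : 0 ≤ fieldStrength h /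
    (Real.exp (3 * fieldStrength h / 4) + Real.exp (-(3 * fieldStrength h / 4))) := by positivity
  linarith

/-- A finite set of unit vectors which detects norms up to a factor `2`. -/
theorem exists_finset_norm_le_two_mul_inner (N : ℕ) :
    ∃ T : Finset (EuclideanSpace ℝ (Fin N)), (∀ θ ∈ T, ‖θ‖ = 1) ∧
      ∀ y : EuclideanSpace ℝ (Fin N), y ≠ 0 → ∃ θ ∈ T, ‖y‖ / 2 ≤ inner ℝ θ y := by
  -- A `1 / 2`-net: replacing `y / ‖y‖` by a nearby `θ` loses at most `‖y‖ / 2` in the inner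
  -- product.
  obtain ⟨t, hts, htf, hcov⟩ :=
    (isCompact_sphere (0 : EuclideanSpace ℝ (Fin N)) 1).finite_cover_balls
      (show (0 : ℝ) < 1 / 2 by norm_num)
  refine ⟨htf.toFinset, fun θ hθ => ?_, fun y hy => ?_⟩
  · simpa using hts (htf.mem_toFinset.1 hθ)
  · have hy0 : 0 < ‖y‖ := norm_pos_iff.2 hy
    have hu : ‖y‖⁻¹ • y ∈ Metric.sphere (0 : EuclideanSpace ℝ (Fin N)) 1 := by
      simp [norm_smul, hy0.ne']
    obtain ⟨θ, hθ, hd⟩ := Set.mem_iUnion₂.1 (hcov hu)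
    refine ⟨θ, htf.mem_toFinset.2 hθ, ?_⟩
    rw [Metric.mem_ball, dist_eq_norm] at hd
    have h1 : inner ℝ (‖y‖⁻¹ • y) y = ‖y‖ := by
      rw [real_inner_smul_left, real_inner_self_eq_norm_sq]
      field_simp
    have h2 : inner ℝ (‖y‖⁻¹ • y - θ) y ≤ 1 / 2 * ‖y‖ :=
      (real_inner_le_norm _ _).trans (by gcongr)
    rw [inner_sub_left, h1] at h2
    linarith

theorem mainTheorem7 :
    ∃ c : ℝ, 0 < c ∧ ∀ N : ℕ, 0 < N →
      ∃ A B : MvPolynomial (Fin 2 ⊕ Config N) ℝ,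
        ∀ (β : ℝ) (W : Matrix (Fin N) (Fin N) ℝ) (h : Fin N → ℝ),
          0 ≤ β → W.IsSymm → LargeField β W h →
        ∀ q : Config N → ℝ, (∀ x, 0 ≤ q x) → ∑ x, q x = 1 →
        ∀ n : ℕ, 0 < n →
          MvPolynomial.eval (chernoffPoint (gammaGap h) n q) B ≠ 0 ∧
          ∀ (Ω : Type*) [MeasurableSpace Ω] (μ : MeasureTheory.Measure Ω)
            [MeasureTheory.IsProbabilityMeasure μ] (X : ℕ → Ω → Config N),
            IsGlauberSample β W h q n μ X →
          ∀ ε : ℝ, 0 < ε →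
            μ.real {ω | ε ≤ ‖((1 / (n : ℝ)) • ∑ i ∈ Finset.range n, (X i ω).toVec)
                - gibbsMean β W h‖} ≤
              MvPolynomial.eval (chernoffPoint (gammaGap h) n q) A /
                MvPolynomial.eval (chernoffPoint (gammaGap h) n q) B *
                Real.exp (-((n : ℝ) * ε ^ 2 * gammaGap h / c)) := by
  refine ⟨768, by norm_num, fun N _ => ?_⟩
  obtain ⟨T, hT1, hT⟩ := exists_finset_norm_le_two_mul_inner N
  -- A constant rational function suffices, as `T` depends only on `N`.
  refine ⟨MvPolynomial.C (T.card * Real.exp N), 1, fun β W h hβ hW hL q _ _ n hn =>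
    ⟨by simp, fun Ω _ μ _ X hX ε hε => ?_⟩⟩
  have hR := hL.isInfluenceBound hβ hW
  set Y : Ω → EuclideanSpace ℝ (Fin N) := fun ω =>
    ((1 / (n : ℝ)) • ∑ i ∈ Finset.range n, (X i ω).toVec) - gibbsMean β W h
  have hsub : {ω | ε ≤ ‖Y ω‖} ⊆ ⋃ θ ∈ T, {ω | ε / 2 ≤ inner ℝ θ (Y ω)} := by
    intro ω hω
    have hω' : ε ≤ ‖Y ω‖ := hω
    obtain ⟨θ, hθ, hle⟩ := hT (Y ω) (norm_pos_iff.1 (hε.trans_le hω'))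
    exact Set.mem_iUnion₂.2 ⟨θ, hθ, show ε / 2 ≤ inner ℝ θ (Y ω) by linarith⟩
  rw [MvPolynomial.eval_C, map_one, div_one]
  calc μ.real {ω | ε ≤ ‖Y ω‖} ≤ μ.real (⋃ θ ∈ T, {ω | ε / 2 ≤ inner ℝ θ (Y ω)}) :=
        MeasureTheory.measureReal_mono hsub (MeasureTheory.measure_ne_top _ _)
    _ ≤ ∑ θ ∈ T, μ.real {ω | ε / 2 ≤ inner ℝ θ (Y ω)} :=
        MeasureTheory.measureReal_biUnion_finset_le _ _
    _ ≤ ∑ θ ∈ T, Real.exp (N - n * ε ^ 2 / 768) :=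
        Finset.sum_le_sum fun θ hθ => hX.real_inner_ge_le hR hn (hT1 θ hθ) hε
    _ = T.card * Real.exp N * Real.exp (-(n * ε ^ 2 / 768)) := by
        rw [Finset.sum_const, nsmul_eq_mul, mul_assoc, ← Real.exp_add, sub_eq_add_neg]
    _ ≤ T.card * Real.exp N * Real.exp (-((n : ℝ) * ε ^ 2 * gammaGap h / 768)) := by
        refine mul_le_mul_of_nonneg_left (Real.exp_le_exp.2 (neg_le_neg
          (div_le_div_of_nonneg_right ?_ (by norm_num)))) (by positivity)
        exact mul_le_of_le_one_right (by positivity) (gammaGap_le_one h)
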